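/- **Conventions.** A relation $R\subseteq (A^*)^n$ over a finite alphabet $A$ is *regular* if $\{\mathrm{conv}(w):w\in R\}$ is a regular language over $(A\cup\{\$\})^n$, where $\mathrm{conv}$ writes the $n$ words one above the other, padding the shorter ones at the right end with a new symbol $\$$. A structure $\mathcal S$ is *FA-presentable* if there are a regular language $L$ over a finite alphabet and a surjection $\phi:L\to\mathcal S$ such that for equality, each relation of $\mathcal S$ and the graph of each operation of $\mathcal S$ (of arity $r$ as a relation), the set of those $(w_1,\dots,w_r)\in L^r$ whose images under $\phi$ are so related is regular. **The algebra $\mathcal X$.** For each integer $i\ge 0$ let $M_i$ be a chain of $2^i$ elements, and let $S$ be the zero-union of the $M_i$: the disjoint union of all the $M_i$ and a zero $0_S$, a meet-semilattice in which elements of different chains have meet $0_S$. Let $T$ be a deterministic Turing machine with one two-way infinite tape, finite state set $Q$, finite tape alphabet $B$ (containing the blank) and total transition function, with a distinguished state $q_\square$ and a distinguished non-blank symbol $a\in B$. Write a configuration of $T$ as an instantaneous description $uqv$ ($u,v\in B^*$, $q\in Q$), where $q$ is the state, $uv$ the tape contents, the head is at the first symbol of $v$ (at the cell just after $u$ if $v$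 is empty), all other cells are blank, and, so that the description is unique, $u$ does not begin and $v$ does not end with a blank. Suppose that $T$, started on the empty tape, arrives successively in state $q_\square$ with tape contents $a^{1^2}, a^{2^2}, a^{3^2},\dots$, and that in this computation, whenever the state is $q_\square$, the tape contents are $a^{j^2}$ for some $j\ge1$. Let $G_\top$ and $G_\bot$ be two copies of the set of all configurations of $T$ (reachable or not), and fix a linear order on $B\cup Q$ (taken disjoint). Let $X=S\cup G_\top\cup G_\bot$ (a disjoint union), with the following operations: * $\circ$ is binary: it is the meet on $S$, and $g\circ g'=g$, $g\circ s=s\circ g=g$ for $g,g'\in G_\top\cup G_\bot$, $s\in S$; * $\alpha$ maps each configuration in $G_\top$ to the corresponding one in $G_\bot$; * $\beta$ maps each element of $M_i$ to the one immediately below it in $M_i$, and the minimum of $M_i$ to $0_S$; * $\gamma$ maps each configuration in $G_\bot$ with state $q_\square$ and tape contents $a^k$ ($k\ge 0$) to the maximum of $M_k$; * $\delta$ maps each configuration in $G_\bot$ to the one that $T$ reaches from it in one step; * $\zeta$ maps each configuration in $G_\top$ to its successor in $G_\top$ in the length-plus-lexicographic order of the descriptions $uqv$; and each of the unary operations $\alpha,\beta,\gamma,\delta,\zeta$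 fixes all other elements. Put $\mathcal X=(X,\circ,\alpha,\beta,\gamma,\delta,\zeta)$, let $g_0\in G_\bot$ be the initial configuration of $T$ (initial state, empty tape), and let $\mathcal Y$ be the subalgebra of $\mathcal X$ generated by $g_0$. **Statement.** Machines $T$ as described exist. For every such $T$ and every linear order on $B\cup Q$: 1. $\mathcal X$ is FA-presentable and finitely generated; 2. the domain of $\mathcal Y$ is $\{0_S\}\cup H\cup\bigcup_{j\ge1}M_{j^2}$, where $H\subseteq G_\bot$ is the set of configurations reachable from $g_0$; in particular $\mathcal Y$ contains every element of the chains $M_{j^2}$, $j\ge 1$, and no element of any other chain; 3. $\mathcal Y$ is not FA-presentable. Consequently, finitely generated subalgebras of finitely generated FA-presentable algebras (with finitely many operations) need not be FA-presentable. -/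

import Mathlib

/-! ### Automatic presentations -/

namespace FA

/-- The convolution of an `n`-tuple of words over `A`: a word over `(A ∪ {$})^n`, whose length is
the maximum of the lengths. The padding symbol `$` is `none`. -/
def conv {A : Type} {n : ℕ} (w : Fin n → List A) : List (Fin n → Option A) :=
  (List.range (Finset.univ.sup fun i => (w i).length)).map fun k i => (w i)[k]?

/-- A relation on words is regular if the set of convolutions of its tuples is a regular
language over `(A ∪ {$})^n`. -/
def RegularRel {A : Type} {n : ℕ} (R : Set (Fin n → List A)) : Prop :=
  Language.IsRegular (conv '' R : Language (Fin n → Option A))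

/-- `Λ(R, φ)`: the tuples of words in `K` whose images under `φ` are related by `R`. -/
def pullback {A S : Type} {K : Language A} (φ : {w : List A // w ∈ K} → S) {n : ℕ}
    (R : (Fin n → S) → Prop) : Set (Fin n → List A) :=
  {w | ∃ h : ∀ i, w i ∈ K, R fun i => φ ⟨w i, h i⟩}

/-- `(K, φ)` is an automatic presentation of the structure `S`: `K` is a regular language over a
finite alphabet, `φ : K → S` is surjective, and equality, every relation of `S` and the graph
of every operation of `S` pull back to regular relations. -/
structure IsPresentation (𝓛 : FirstOrder.Language.{0, 0}) (S : Type) [𝓛.Structure S]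
    {A : Type} (K : Language A) (φ : {w : List A // w ∈ K} → S) : Prop where
  finite_alphabet : Finite A
  regular : K.IsRegular
  surjective : Function.Surjective φ
  eq_regular : RegularRel (pullback φ fun x : Fin 2 → S => x 0 = x 1)
  rel_regular : ∀ (n : ℕ) (r : 𝓛.Relations n),
    RegularRel (pullback φ fun x : Fin n → S => FirstOrder.Language.Structure.RelMap r x)
  fun_regular : ∀ (n : ℕ) (f : 𝓛.Functions n),
    RegularRel (pullback φ fun x : Fin (n + 1) → S =>
      FirstOrder.Language.Structure.funMap f (fun i : Fin n => x i.castSucc) = x (Fin.last n))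

/-- A structure is FA-presentable if it has an automatic presentation. -/
def Presentable (𝓛 : FirstOrder.Language.{0, 0}) (S : Type) [𝓛.Structure S] : Prop :=
  ∃ (A : Type) (K : Language A) (φ : {w : List A // w ∈ K} → S), IsPresentation 𝓛 S K φ

end FA

/-! ### Turing machines and their configurations -/

namespace SquareAlgebra

/-- A deterministic Turing machine with one two-way infinite tape, with tape alphabet `B` (whose
blank symbol is `default`) and state set `Q`. The transition function is total, so that every
configuration has exactly one successor. A state `sq` and a non-blank symbol `a` are
distinguished. -/
structure Machine (B Q : Type) [Inhabited B] where
  start : Q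
  sq : Q
  a : B
  a_ne_blank : a ≠ default
  trans : Q → B → Q × B × Turing.Dir

/-- A configuration: a state and a tape with a head position (`Turing.Tape` is the tape as seen
from the head). All configurations are allowed, reachable or not. -/
@[ext] structure Config (B Q : Type) [Inhabited B] where
  state : Q
  tape : Turing.Tape B

open Classical in
/-- The symbols of a half-tape up to its last non-blank symbol. -/
noncomputable def trim {B : Type} [Inhabited B] (l : Turing.ListBlank B) : List B :=
  l.liftOn (List.rdropWhile fun b => decide (b = default)) (by
    rintro l _ ⟨n, rfl⟩
    induction n with
    | zero => simp
    | succ n ih =>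
      rw [List.replicate_succ', ← List.append_assoc, List.rdropWhile_concat_pos _ _ _ (by simp)]
      exact ih)

namespace Config

variable {B Q : Type} [Inhabited B]

/-- The word `u` in the instantaneous description `u q v`: the tape to the left of the head,
in the order of the tape, without blanks at the outer end. -/
noncomputable def left (c : Config B Q) : List B := (trim c.tape.left).reverse

/-- The word `v` in the instantaneous description `u q v`: the tape from the head rightwards,
without blanks at the outer end. -/
noncomputable def right (c : Config B Q) : List B := trim (c.tape.right.cons c.tape.head)

/-- The instantaneous description `u q v`, a word in `B* Q B*`. -/
noncomputable def word (c : Config B Q) : List (B ⊕ Q) :=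
  c.left.map Sum.inl ++ Sum.inr c.state :: c.right.map Sum.inl

/-- The tape contents `u v`. -/
noncomputable def contents (c : Config B Q) : List B := c.left ++ c.right

end Config

namespace Machine

variable {B Q : Type} [Inhabited B] (T : Machine B Q)

/-- One computation step: change the state, write a symbol and move the head. -/
def step (c : Config B Q) : Config B Q :=
  let t := T.trans c.state c.tape.head
  ⟨t.1, (c.tape.write t.2.1).move t.2.2⟩

/-- The initial configuration: the initial state and the empty tape. -/
def init : Config B Q := ⟨T.start, Turing.Tape.mk₁ []⟩

/-- `c` is a configuration with state `sq` and tape contents `a ^ k`. -/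
def Outputs (c : Config B Q) (k : ℕ) : Prop :=
  c.state = T.sq ∧ c.contents = List.replicate k T.a

/-- Started on the empty tape, the machine arrives successively, at times `t 1 < t 2 < ⋯`, in
state `sq` with tape contents `a ^ 1²`, `a ^ 2²`, …, and whenever it is in state `sq`, its tape
contents are `a ^ j²` for some `j ≥ 1`. -/
def GeneratesSquares : Prop :=
  (∃ t : ℕ → ℕ, StrictMono t ∧ ∀ j, 1 ≤ j → T.Outputs (T.step^[t j] T.init) (j ^ 2)) ∧
  ∀ n, (T.step^[n] T.init).state = T.sq → ∃ j, 1 ≤ j ∧ T.Outputs (T.step^[n] T.init) (j ^ 2)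

end Machine

/-! ### The algebra -/

/-- `c ⊏ d`: length-plus-lexicographic order of instantaneous descriptions. -/
def Precedes {B Q : Type} [Inhabited B] (ord : LinearOrder (B ⊕ Q)) (c d : Config B Q) : Prop :=
  List.Shortlex ord.lt c.word d.word

/-- `d` is the next configuration after `c` in the length-plus-lexicographic order. -/
def IsNext {B Q : Type} [Inhabited B] (ord : LinearOrder (B ⊕ Q)) (c d : Config B Q) : Prop :=
  Precedes ord c d ∧ ∀ e, Precedes ord c e → e = d ∨ Precedes ord d e

open Classical in
/-- The configuration that succeeds `c` in the length-plus-lexicographic order. (When `B` and `Q`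
are finite and `B` has a non-blank symbol, it always exists and is unique.) -/
noncomputable def next {B Q : Type} [Inhabited B] (ord : LinearOrder (B ⊕ Q)) (c : Config B Q) :
    Config B Q :=
  if h : ∃ d, IsNext ord c d then h.choose else c

/-- The carrier of the algebra built from the machine `T` and the order `ord`: the zero `0_S`, the
chains `M_i` (`chain i k` is the element number `k` of `M_i`, counted from the bottom, starting
with `0`), and two copies of the set of configurations. -/
inductive X {B Q : Type} [Inhabited B] (T : Machine B Q) (ord : LinearOrder (B ⊕ Q)) : Type
  | zero : X T ord
  | chain (i : ℕ) (k : Fin (2 ^ i)) : X T ord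
  | top (c : Config B Q) : X T ord
  | bot (c : Config B Q) : X T ord

namespace X

variable {B Q : Type} [Inhabited B] {T : Machine B Q} {ord : LinearOrder (B ⊕ Q)}

/-- The maximum element of the chain `M_i`. -/
def chainMax (i : ℕ) : X T ord := chain i ⟨2 ^ i - 1, Nat.sub_lt (Nat.two_pow_pos i) one_pos⟩

/-- The multiplication `∘`: the meet on the zero-union `S` of the chains; and
`g ∘ g' = g`, `g ∘ s = s ∘ g = g` for configurations `g`, `g'` and `s ∈ S`. -/
def mul : X T ord → X T ord → X T ord
  | top c, _ => top c
  | bot c, _ => bot c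
  | zero, top c => top c
  | chain _ _, top c => top c
  | zero, bot c => bot c
  | chain _ _, bot c => bot c
  | zero, zero => zero
  | zero, chain _ _ => zero
  | chain _ _, zero => zero
  | chain i k, chain j l =>
    if i = j then chain i ⟨min k.1 l.1, lt_of_le_of_lt (min_le_left _ _) k.2⟩ else zero

/-- `α` maps a configuration in the copy `top` to its counterpart in the copy `bot`. -/
def alpha : X T ord → X T ord
  | top c => bot c
  | x => x

/-- `β` moves down by one in each chain, and maps its minimum to `0_S`. -/
def beta : X T ord → X T ord
  | chain i k => if k.1 = 0 then zero else chain i ⟨k.1 - 1, lt_of_le_of_lt (Nat.sub_le _ _) k.2⟩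
  | x => x

open Classical in
/-- `γ` maps a configuration in the copy `bot` with state `sq` and tape contents `a ^ k` to the
maximum of `M_k`. -/
noncomputable def gamma : X T ord → X T ord
  | bot c => if T.Outputs c c.contents.length then chainMax c.contents.length else bot c
  | x => x

/-- `δ` performs a computation step in the copy `bot`. -/
def delta : X T ord → X T ord
  | bot c => bot (T.step c)
  | x => x

/-- `ζ` runs through the copy `top` in length-plus-lexicographic order. -/
noncomputable def zeta : X T ord → X T ord
  | top c => top (next ord c)
  | x => x

end X

/-- The operation symbols: one binary and five unary ones. -/
inductive Op : ℕ → Type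
  | mul : Op 2
  | alpha : Op 1
  | beta : Op 1
  | gamma : Op 1
  | delta : Op 1
  | zeta : Op 1

/-- The signature of the algebra. -/
def sig : FirstOrder.Language.{0, 0} := ⟨Op, fun _ => Empty⟩

noncomputable instance {B Q : Type} [Inhabited B] (T : Machine B Q) (ord : LinearOrder (B ⊕ Q)) :
    sig.Structure (X T ord) where
  funMap f x := match f with
    | .mul => X.mul (x 0) (x 1)
    | .alpha => X.alpha (x 0)
    | .beta => X.beta (x 0)
    | .gamma => X.gamma (x 0)
    | .delta => X.delta (x 0)
    | .zeta => X.zeta (x 0)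
  RelMap r _ := r.elim

/-- The subalgebra generated by the initial configuration in the copy `bot`. -/
noncomputable def Y {B Q : Type} [Inhabited B] (T : Machine B Q) (ord : LinearOrder (B ⊕ Q)) :
    sig.Substructure (X T ord) :=
  FirstOrder.Language.Substructure.closure sig {X.bot T.init}

end SquareAlgebra

/-! Presentability of $\mathcal X$ rests on the closure of automatic relations under first-order
definitions. `Rec` describes predicates on tuples of words that an automaton decides on convolutions
with any sufficient padding; in this form Boolean operations, reindexing and quantifiers (`Rec.ex`,
`Rec.all`) are easy, and `RegularRel.rec`, `Rec.regularRel` translate to and from regularity.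
Configurations are coded by their descriptions, and the elements of $M_i$ by binary words of length
$i$, each behind a mark. The order in a chain is then lexicographic order at equal length. A machine
step rewrites a window of at most three letters once spare blanks are supplied (`word_step_iff`),
the successor is definable from the length-plus-lexicographic order (`rec_next`), and $\gamma$
compares lengths.

$\mathcal X$ is generated by the least configuration in $G_\top$: $\zeta$ reaches all of $G_\top$,
$\alpha$ all of $G_\bot$, $\gamma$ every chain maximum, and $\beta$ the rest. From $g_0$, by
contrast, only the actual computation is reached, so only the chains of square index appear
(`coe_Y`).

A presentation of $\mathcal Y$ is refuted by counting (`not_presentable_Y`). Taking shortlex-least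
representatives, the maxima of the chains of $\mathcal Y$ form an infinite regular language with one
word for each $j\ge1$. A maximum has only finitely many elements below it, so by pumping
(`Rec.exists_length_le`) their representatives are longer than its word $u$ by at most a constant
$c$. There are at least $2^{j^2}$ of them, whence $j^2\le d(|u|+c)$ for a constant $d$. But an
infinite regular language contains words whose lengths form an arithmetic progression, and since
distinct words have distinct indices $j$, some $j^2$ exceeds this linear bound
(`exists_lt_sq_of_isRegular`).

Existence of a suitable machine is shown by the explicit `Machine.squares`, which uses
$(j+1)^2=j^2+2j+1$. -/

namespace FA

/-! ### Closure properties of regular languages -/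

section Regular

variable {α β : Type}

/-- The image of a regular language under a letter-to-letter map is regular. -/
theorem isRegular_map {L : Language α} (h : L.IsRegular) (f : α → β) :
    Language.IsRegular ({x | ∃ y ∈ L, y.map f = x} : Set (List β)) := by
  obtain ⟨σ, _, M, rfl⟩ := h
  -- The automaton guesses a preimage of each letter and runs `M` on the guesses.
  let N : NFA β σ := ⟨fun s b => {t | ∃ a, f a = b ∧ t = M.step s a}, {M.start}, M.accept⟩
  have key : ∀ (x : List β) (s t : σ),
      t ∈ N.evalFrom {s} x ↔ ∃ y : List α, y.map f = x ∧ M.evalFrom s y = t := by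
    intro x
    induction x with
    | nil => intro s t; simp [eq_comm]
    | cons b x ih =>
      intro s t
      rw [NFA.evalFrom_cons, NFA.stepSet_singleton, NFA.mem_evalFrom_iff_exists]
      constructor
      · rintro ⟨_, ⟨a, rfl, rfl⟩, h⟩
        obtain ⟨y, rfl, rfl⟩ := (ih _ _).1 h
        exact ⟨a :: y, rfl, rfl⟩
      · rintro ⟨y, hy, rfl⟩
        obtain ⟨a, y, rfl, rfl, rfl⟩ := List.map_eq_cons_iff.1 hy
        exact ⟨_, ⟨a, rfl, rfl⟩, (ih _ _).2 ⟨y, rfl, rfl⟩⟩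
  refine ⟨Set σ, inferInstance, N.toDFA, ?_⟩
  rw [NFA.toDFA_correct]
  ext x
  rw [NFA.mem_accepts]
  constructor
  · rintro ⟨t, ht, hx⟩
    obtain ⟨y, rfl, rfl⟩ := (key _ _ _).1 hx
    exact ⟨y, ht, rfl⟩
  · rintro ⟨y, hy, rfl⟩
    exact ⟨_, hy, (key _ _ _).2 ⟨y, rfl, rfl⟩⟩

theorem isRegular_comap {L : Language β} (h : L.IsRegular) (f : α → β) :
    Language.IsRegular ({x | x.map f ∈ L} : Set (List α)) := by
  obtain ⟨σ, _, M, rfl⟩ := h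
  exact ⟨σ, inferInstance, M.comap f, M.accepts_comap f⟩

/-- The quotient of a regular language by the powers of a letter is regular. -/
theorem isRegular_quotient_replicate {L : Language α} (h : L.IsRegular) (a : α) :
    Language.IsRegular ({x | ∃ k, x ++ List.replicate k a ∈ L} : Set (List α)) := by
  obtain ⟨σ, _, M, rfl⟩ := h
  refine ⟨σ, inferInstance,
    ⟨M.step, M.start, {s | ∃ k, M.evalFrom s (List.replicate k a) ∈ M.accept}⟩, ?_⟩
  ext x
  change (∃ k, M.evalFrom (M.eval x) _ ∈ M.accept) ↔ ∃ k, M.evalFrom _ _ ∈ M.accept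
  simp only [DFA.evalFrom_of_append]
  rfl

end Regular

/-! ### Padded convolutions and recognizable predicates -/

variable {A ι κ : Type}

/-- The convolution of a tuple of words of length at most `N`, padded to length `N`. -/
def padConv (N : ℕ) (w : ι → List A) : List (ι → Option A) :=
  (List.range N).map fun k i => (w i)[k]?

/-- The letter consisting of padding symbols only. -/
def blankLetter : ι → Option A := fun _ => none

theorem padConv_succ (N : ℕ) (w : ι → List A) :
    padConv (N + 1) w = padConv N w ++ [fun i => (w i)[N]?] := by
  simp [padConv, List.range_succ]

theorem padConv_succ' (N : ℕ) (w : ι → List A) :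
    padConv (N + 1) w = (fun i => (w i).head?) :: padConv N fun i => (w i).tail := by
  simp [padConv, List.range_succ_eq_map, Function.comp_def, List.head?_eq_getElem?]

theorem length_padConv (N : ℕ) (w : ι → List A) : (padConv N w).length = N := by
  simp [padConv]

theorem padConv_add {N : ℕ} {w : ι → List A} (h : ∀ i, (w i).length ≤ N) (k : ℕ) :
    padConv (N + k) w = padConv N w ++ List.replicate k blankLetter := by
  induction k with
  | zero => simp
  | succ k ih =>
    rw [← add_assoc, padConv_succ, ih, List.replicate_succ', List.append_assoc]
    congr 3
    funext i
    exact List.getElem?_eq_none ((h i).trans (Nat.le_add_right _ _))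

theorem padConv_map (f : κ → ι) (N : ℕ) (w : ι → List A) :
    (padConv N w).map (fun l k => l (f k)) = padConv N fun k => w (f k) := by
  simp [padConv, Function.comp_def]

theorem padConv_injective {N : ℕ} {w w' : ι → List A} (h : ∀ i, (w i).length ≤ N)
    (h' : ∀ i, (w' i).length ≤ N) (e : padConv N w = padConv N w') : w = w' := by
  funext i
  refine List.ext_getElem? fun k => ?_
  rcases lt_or_ge k N with hk | hk
  · have := congrArg (fun l => l[k]?.map (fun s => s i)) e
    simpa [padConv, hk] using this
  · rw [List.getElem?_eq_none ((h i).trans hk), List.getElem?_eq_none ((h' i).trans hk)]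

/-- A predicate on tuples of words is recognizable if a regular language decides it on the padded
convolutions of the tuples. -/
def Rec (P : (ι → List A) → Prop) : Prop :=
  ∃ L : Language (ι → Option A), L.IsRegular ∧
    ∀ w N, (∀ i, (w i).length ≤ N) → (padConv N w ∈ L ↔ P w)

namespace Rec

theorem not {P : (ι → List A) → Prop} (h : Rec P) : Rec fun w => ¬ P w := by
  obtain ⟨L, hL, h⟩ := h
  exact ⟨Lᶜ, hL.compl, fun w N hN => not_congr (h w N hN)⟩

theorem and {P Q : (ι → List A) → Prop} (h : Rec P) (h' : Rec Q) : Rec fun w => P w ∧ Q w := by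
  obtain ⟨L, hL, h⟩ := h
  obtain ⟨L', hL', h'⟩ := h'
  exact ⟨L ⊓ L', hL.inf hL', fun w N hN => and_congr (h w N hN) (h' w N hN)⟩

theorem congr {P Q : (ι → List A) → Prop} (h : Rec P) (e : ∀ w, Q w ↔ P w) : Rec Q := by
  obtain rfl : Q = P := funext fun w => propext (e w)
  exact h

theorem or {P Q : (ι → List A) → Prop} (h : Rec P) (h' : Rec Q) : Rec fun w => P w ∨ Q w :=
  (h.not.and h'.not).not.congr fun _ => by tauto

theorem imp {P Q : (ι → List A) → Prop} (h : Rec P) (h' : Rec Q) : Rec fun w => P w → Q w :=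
  (h.and h'.not).not.congr fun _ => by tauto

theorem comp {P : (κ → List A) → Prop} (h : Rec P) (f : κ → ι) :
    Rec fun w : ι → List A => P fun k => w (f k) := by
  obtain ⟨L, hL, h⟩ := h
  refine ⟨_, isRegular_comap hL fun l k => l (f k), fun w N hN => ?_⟩
  exact (iff_of_eq (congrArg (· ∈ L) (padConv_map f N w))).trans
    (h (fun k => w (f k)) N fun k => hN (f k))

end Rec

/-- Padded convolutions form a regular language. -/
theorem isRegular_range_padConv [Finite ι] :
    Language.IsRegular ({x | ∃ (N : ℕ) (w : ι → List A), (∀ i, (w i).length ≤ N) ∧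
      padConv N w = x} : Set (List (ι → Option A))) := by
  classical
  have := Fintype.ofFinite ι
  -- A live state is the set of tracks on which the last letter was padding; a proper letter on such
  -- a track leads to the dead state `none`.
  let M : DFA (ι → Option A) (Option (Set ι)) :=
    ⟨fun s l => s.bind fun E => if ∃ i ∈ E, l i ≠ none then none else some {i | l i = none},
      some ∅, {none}ᶜ⟩
  have dead : ∀ x, M.evalFrom none x = none := fun x => by
    induction x with
    | nil => rfl
    | cons a x ih => exact ih
  have key : ∀ (x : List (ι → Option A)) (E : Set ι), M.evalFrom (some E) x ≠ none ↔
      ∃ w : ι → List A, (∀ i, (w i).length ≤ x.length) ∧ padConv x.length w = x ∧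
        ∀ i ∈ E, w i = [] := by
    intro x
    induction x with
    | nil =>
      intro E
      refine iff_of_true (by simp) ⟨fun _ => [], by simp, rfl, fun _ _ => rfl⟩
    | cons l x ih =>
      intro E
      rw [DFA.evalFrom_cons]
      change M.evalFrom (if ∃ i ∈ E, l i ≠ none then none else some {i | l i = none}) x ≠ none ↔ _
      split_ifs with hE
      · refine iff_of_false (by simp [dead]) ?_
        rintro ⟨w, -, h, hw⟩
        obtain ⟨i, hi, hl⟩ := hE
        rw [List.length_cons, padConv_succ', List.cons.injEq] at h
        exact hl (by rw [← h.1]; simp [hw i hi])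
      · rw [ih]
        push Not at hE
        constructor
        · rintro ⟨w, hlen, hx, hw⟩
          refine ⟨fun i => match l i with | none => [] | some a => a :: w i, ?_, ?_, ?_⟩
          · intro i
            dsimp only
            split <;> simp [hlen]
          · rw [List.length_cons, padConv_succ']
            congr 1
            · funext i
              cases l i <;> rfl
            · conv_rhs => rw [← hx]
              congr 1
              funext i
              rcases h : l i with _ | a
              · simp [hw i h]
              · simp
          · intro i hi
            simp only [hE i hi]
        · rintro ⟨w, hlen, hx, hw⟩
          rw [List.length_cons, padConv_succ', List.cons.injEq] at hx
          refine ⟨fun i => (w i).tail, fun i => ?_, hx.2, fun i hi => ?_⟩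
          · have := hlen i
            simp only [List.length_cons] at this
            simp only [List.length_tail]
            omega
          · have : (w i).head? = none := by rw [← hx.1] at hi; exact hi
            simp_all
  refine ⟨Option (Set ι), inferInstance, M, ?_⟩
  ext x
  refine (key x ∅).trans ⟨?_, ?_⟩
  · rintro ⟨w, h, hx, -⟩
    exact ⟨_, w, h, hx⟩
  · rintro ⟨N, w, h, rfl⟩
    exact ⟨w, by simpa [length_padConv] using h, by rw [length_padConv], by simp⟩

namespace Rec

theorem ex [Finite ι] {P : (ι → List A) → List A → Prop}
    (h : Rec fun w : Option ι → List A => P (fun i => w (some i)) (w none)) :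
    Rec fun w => ∃ v, P w v := by
  obtain ⟨L, hL, h⟩ := h
  -- Projection erases the track of the witness. Since the witness may be longer than all other
  -- words, all-padding letters can remain at the end, and the quotient removes them. The
  -- intersection with the padded convolutions ensures that the erased track was a word.
  refine ⟨_, isRegular_quotient_replicate (isRegular_map
    (hL.inf (isRegular_range_padConv (A := A) (ι := Option ι)))
    fun l i => l (some i)) blankLetter, fun w N hN => ?_⟩
  change (∃ k x, (x ∈ L ∧ ∃ (N : ℕ) (w : Option ι → List A), (∀ i, (w i).length ≤ N) ∧
    padConv N w = x) ∧ x.map _ = _) ↔ _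
  constructor
  · rintro ⟨k, _, ⟨hx, N', w', hw', rfl⟩, e⟩
    rw [padConv_map, ← padConv_add hN] at e
    have hN' : N' = N + k := by simpa [length_padConv] using congrArg List.length e
    subst hN'
    have hww := padConv_injective (fun i => hw' (some i))
      (fun i => (hN i).trans (Nat.le_add_right _ _)) e
    refine ⟨w' none, ?_⟩
    rw [← hww]
    exact (h _ _ hw').1 hx
  · rintro ⟨v, hv⟩
    let w' : Option ι → List A := fun o => o.elim v w
    have hw' : ∀ i, (w' i).length ≤ N + v.length := by
      rintro (_ | i)
      · exact Nat.le_add_left _ _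
      · exact (hN i).trans (Nat.le_add_right _ _)
    refine ⟨v.length, padConv (N + v.length) w', ⟨(h w' _ hw').2 hv, _, w', hw', rfl⟩, ?_⟩
    rw [padConv_map, ← padConv_add hN]
    rfl

theorem all [Finite ι] {P : (ι → List A) → List A → Prop}
    (h : Rec fun w : Option ι → List A => P (fun i => w (some i)) (w none)) :
    Rec fun w => ∀ v, P w v :=
  (Rec.ex (P := fun w v => ¬ P w v) h.not).not.congr fun _ => by simp

/-- A finite family of predicates that is closed under reading the first letters of all words
consists of recognizable predicates. -/
theorem of_step {S : Type} [Finite S] {P : S → (ι → List A) → Prop}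
    (step : S → (ι → Option A) → S)
    (h : ∀ s w, P s w ↔ P (step s fun i => (w i).head?) fun i => (w i).tail) (s : S) :
    Rec (P s) := by
  have := Fintype.ofFinite S
  -- Acceptance evaluates the predicate at empty words. The hypothesis `h` at empty words makes this
  -- insensitive to further padding.
  let M : DFA (ι → Option A) S := ⟨step, s, {s | P s fun _ => []}⟩
  refine ⟨M.accepts, ⟨S, inferInstance, M, rfl⟩, fun w N hN => ?_⟩
  have key : ∀ N (w : ι → List A) s, (∀ i, (w i).length ≤ N) →
      (M.evalFrom s (padConv N w) ∈ M.accept ↔ P s w) := by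
    intro N
    induction N with
    | zero =>
      intro w s hw
      have : w = fun _ => [] := funext fun i => List.length_eq_zero_iff.1 (Nat.le_zero.1 (hw i))
      rw [this]
      rfl
    | succ N ih =>
      intro w s hw
      rw [padConv_succ', DFA.evalFrom_cons, ih _ _ fun i => ?_, h s w]
      have := hw i
      rw [List.length_tail]
      omega
  exact key N w s hN

theorem of_step₁ {S : Type} [Finite S] {P : S → List A → Prop} (step : S → Option A → S)
    (cons : ∀ s a x, P s (a :: x) ↔ P (step s (some a)) x)
    (nil : ∀ s, P s [] ↔ P (step s none) []) (s : S) (i : ι) : Rec fun w => P s (w i) :=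
  of_step (P := fun s w => P s (w i)) (fun s l => step s (l i)) (fun s w => by
    dsimp only
    rcases w i with _ | ⟨a, x⟩
    · exact nil s
    · exact cons s a x) s

theorem of_step₂ {S : Type} [Finite S] {P : S → List A → List A → Prop}
    (step : S → Option A → Option A → S)
    (cons_cons : ∀ s a b x y, P s (a :: x) (b :: y) ↔ P (step s (some a) (some b)) x y)
    (cons_nil : ∀ s a x, P s (a :: x) [] ↔ P (step s (some a) none) x [])
    (nil_cons : ∀ s b y, P s [] (b :: y) ↔ P (step s none (some b)) [] y)
    (nil_nil : ∀ s, P s [] [] ↔ P (step s none none) [] []) (s : S) (i j : ι) :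
    Rec fun w => P s (w i) (w j) :=
  of_step (P := fun s w => P s (w i) (w j)) (fun s l => step s (l i) (l j)) (fun s w => by
    dsimp only
    rcases w i with _ | ⟨a, x⟩ <;> rcases w j with _ | ⟨b, y⟩
    · exact nil_nil s
    · exact nil_cons s b y
    · exact cons_nil s a x
    · exact cons_cons s a b x y) s

end Rec

/-! ### Recognizable predicates and regular relations -/

section RegularRel

variable {n : ℕ}

theorem conv_eq_padConv (w : Fin n → List A) :
    conv w = padConv (Finset.univ.sup fun i => (w i).length) w := rfl

theorem letter_ne_blank {w : Fin n → List A} {N : ℕ}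
    (h : (Finset.univ.sup fun i => (w i).length) = N + 1) :
    (fun i => (w i)[N]?) ≠ blankLetter := by
  intro e
  have : (Finset.univ.sup fun i => (w i).length) ≤ N :=
    Finset.sup_le fun i _ => List.getElem?_eq_none_iff.1 (congrFun e i)
  omega

/-- An automaton for the exact convolutions has to ignore any superfluous padding, so its state at
the last letter that is not all padding is kept in a second component, which decides acceptance. -/
theorem RegularRel.rec {R : Set (Fin n → List A)} (h : RegularRel R) : Rec fun w => w ∈ R := by
  classical
  obtain ⟨σ, _, M, hM⟩ := h
  let M' : DFA (Fin n → Option A) (σ × σ) :=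
    ⟨fun s l => (M.step s.1 l, if l = blankLetter then s.2 else M.step s.1 l),
      (M.start, M.start), {s | s.2 ∈ M.accept}⟩
  have fst : ∀ x, (M'.eval x).1 = M.eval x := fun x => by
    induction x using List.reverseRecOn with
    | nil => rfl
    | append_singleton x l ih =>
      rw [DFA.eval_append_singleton, DFA.eval_append_singleton, ← ih]
  have snd : ∀ N (w : Fin n → List A), (∀ i, (w i).length ≤ N) →
      (M'.eval (padConv N w)).2 = M.eval (conv w) := by
    intro N
    induction N with
    | zero =>
      intro w hw
      have : (Finset.univ.sup fun i => (w i).length) = 0 := by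
        simpa using fun i => hw i
      rw [conv_eq_padConv, this]
      rfl
    | succ N ih =>
      intro w hw
      rw [padConv_succ, DFA.eval_append_singleton]
      change (if _ then _ else _) = _
      by_cases hN : ∀ i, (w i).length ≤ N
      · rw [if_pos (show _ = blankLetter from funext fun i => List.getElem?_eq_none (hN i)), ih w hN]
      · have hs : (Finset.univ.sup fun i => (w i).length) = N + 1 := by
          refine le_antisymm (Finset.sup_le fun i _ => hw i) ?_
          push Not at hN
          obtain ⟨i, hi⟩ := hN
          exact le_trans hi (Finset.le_sup (f := fun i => (w i).length) (Finset.mem_univ i))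
        rw [if_neg (letter_ne_blank hs), fst, conv_eq_padConv, hs, padConv_succ,
          DFA.eval_append_singleton]
  have inj : ∀ w w' : Fin n → List A, conv w = conv w' → w = w' := by
    intro w w' e
    have hl := congrArg List.length e
    rw [conv_eq_padConv, conv_eq_padConv, length_padConv, length_padConv] at hl
    rw [conv_eq_padConv, conv_eq_padConv, ← hl] at e
    exact padConv_injective (fun i => Finset.le_sup (f := fun i => (w i).length) (Finset.mem_univ i))
      (fun i => hl ▸ Finset.le_sup (f := fun i => (w' i).length) (Finset.mem_univ i)) e
  refine ⟨M'.accepts, ⟨_, inferInstance, M', rfl⟩, fun w N hN => ?_⟩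
  change (M'.eval (padConv N w)).2 ∈ M.accept ↔ _
  rw [snd N w hN, ← DFA.mem_accepts, hM]
  constructor
  · rintro ⟨w', hw', e⟩
    rwa [← inj _ _ e]
  · exact fun h => ⟨w, h, rfl⟩

/-- The exact convolutions are precisely the padded ones that do not end in the all-padding letter,
and this is a regular condition. -/
theorem Rec.regularRel {R : Set (Fin n → List A)} (h : Rec fun w => w ∈ R) : RegularRel R := by
  classical
  obtain ⟨L, hL, h⟩ := h
  let M : DFA (Fin n → Option A) Bool :=
    ⟨fun _ l => decide (l ≠ blankLetter), true, {true}⟩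
  have hM : ∀ x, x ∈ M.accepts ↔ ∀ y, x ≠ y ++ [blankLetter] := fun x => by
    rw [DFA.mem_accepts]
    induction x using List.reverseRecOn with
    | nil => simp [M]
    | append_singleton x l ih =>
      rw [DFA.eval_append_singleton]
      simp [M]
  have : conv '' R = L ⊓ {x | ∃ (N : ℕ) (w : Fin n → List A), (∀ i, (w i).length ≤ N) ∧
      padConv N w = x} ⊓ M.accepts := by
    ext x
    change _ ↔ (x ∈ L ∧ ∃ (N : ℕ) (w : Fin n → List A), (∀ i, (w i).length ≤ N) ∧
      padConv N w = x) ∧ x ∈ M.accepts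
    rw [hM]
    constructor
    · rintro ⟨w, hw, rfl⟩
      have hN : ∀ i, (w i).length ≤ Finset.univ.sup fun i => (w i).length :=
        fun i => Finset.le_sup (f := fun i => (w i).length) (Finset.mem_univ i)
      refine ⟨⟨(h w _ hN).2 hw, _, w, hN, rfl⟩, fun y hy => ?_⟩
      rcases hs : (Finset.univ.sup fun i => (w i).length) with _ | N
      · rw [conv_eq_padConv, hs] at hy
        simp [padConv] at hy
      · rw [conv_eq_padConv, hs, padConv_succ] at hy
        refine letter_ne_blank hs ?_
        simpa using (List.append_inj' hy rfl).2
    · rintro ⟨⟨hx, N, w, hw, rfl⟩, hb⟩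
      refine ⟨w, (h w N hw).1 hx, ?_⟩
      rw [conv_eq_padConv]
      congr 1
      refine le_antisymm (Finset.sup_le fun i _ => hw i) ?_
      by_contra hlt
      rcases N with _ | N
      · simp at hlt
      · refine hb (padConv N w) ?_
        rw [padConv_succ]
        congr 2
        funext i
        refine List.getElem?_eq_none ?_
        have := Finset.le_sup (f := fun i => (w i).length) (Finset.mem_univ i)
        omega
  unfold RegularRel
  rw [this]
  exact (hL.inf isRegular_range_padConv).inf ⟨Bool, inferInstance, M, rfl⟩

end RegularRel

end FA

/-! ### Basic recognizable predicates -/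

namespace FA

theorem shortlex_trichotomy {A : Type} [LinearOrder A] (x y : List A) :
    List.Shortlex (· < ·) x y ∨ x = y ∨ List.Shortlex (· < ·) y x := by
  simp only [List.shortlex_def]
  rcases lt_trichotomy x.length y.length with h | h | h
  · exact Or.inl (Or.inl h)
  · rcases lt_trichotomy x y with h' | h' | h'
    · exact Or.inl (Or.inr ⟨h, h'⟩)
    · exact Or.inr (Or.inl h')
    · exact Or.inr (Or.inr (Or.inr ⟨h.symm, h'⟩))
  · exact Or.inr (Or.inr (Or.inl h))

namespace Rec

variable {A ι : Type}

theorem isRegular {P : List A → Prop} (h : Rec fun w : Fin 1 → List A => P (w 0)) :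
    Language.IsRegular ({x | P x} : Set (List A)) := by
  obtain ⟨L, hL, h⟩ := h
  have := isRegular_comap hL fun a (_ : Fin 1) => some a
  suffices h : ({x | P x} : Set (List A)) = {x | x.map (fun a (_ : Fin 1) => some a) ∈ L} from
    h ▸ this
  ext x
  refine (h (fun _ => x) x.length fun _ => le_rfl).symm.trans (iff_of_eq (congrArg (· ∈ L) ?_))
  refine List.ext_getElem? fun k => ?_
  rcases lt_or_ge k x.length with hk | hk
  · simp [padConv, hk]
  · simp [padConv, hk]

theorem eq_nil (i : ι) : Rec fun w : ι → List A => w i = [] :=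
  of_step₁ (P := fun s x => s = Bool.true ∧ x = []) (fun s a => s && a.isNone) (by simp) (by simp)
    Bool.true i |>.congr (by simp)

theorem eq (i j : ι) : Rec fun w : ι → List A => w i = w j := by
  classical
  exact of_step₂ (P := fun s x y => s = Bool.true ∧ x = y) (fun s a b => s && a = b)
    (by simp [and_assoc]) (by simp) (by simp) (by simp) Bool.true i j |>.congr (by simp)

/-- The relation `y = c :: x` for `s = some (some c)`, the relation `x = y = []` for
`s = some none`, and the empty relation for `s = none`. -/
def ConsState (s : Option (Option A)) (x y : List A) : Prop :=
  match s with
  | none => False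
  | some none => x = [] ∧ y = []
  | some (some c) => y = c :: x

/-- The two words are offset by one letter, so the state stores the last letter read on track `i`,
which has to come next on track `j`. -/
theorem eq_cons [Finite A] (c : A) (i j : ι) : Rec fun w : ι → List A => w j = c :: w i := by
  classical
  refine of_step₂ (P := ConsState) (fun s a b => match s with
    | none => none
    | some none => if a = none ∧ b = none then some none else none
    | some (some c) => if b = some c then some a else none) ?_ ?_ ?_ ?_ (some (some c)) i j
  all_goals
    rintro (_ | _ | c) <;> intros <;> dsimp only <;> (try split_ifs) <;>
      simp_all [ConsState]

theorem eq_const [Finite A] (v : List A) (i : ι) : Rec fun w : ι → List A => w i = v := by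
  classical
  -- The induction adds a track at each letter, so the index type has to vary, and projection needs
  -- it finite; the given `ι` need not be.
  suffices h : ∀ {κ : Type} [Finite κ] (i : κ), Rec fun w : κ → List A => w i = v by
    exact (h (κ := Unit) ()).comp fun _ => i
  induction v with
  | nil => exact fun i => eq_nil i
  | cons a v ih =>
    intro κ _ i
    refine (ex (P := fun w u => u = v ∧ w i = a :: u) ((ih none).and
      (eq_cons a none (some i)))).congr fun w => ?_
    simp

theorem exists_eq_append_replicate (b : A) (i j : ι) :
    Rec fun w : ι → List A => ∃ k, w j = w i ++ List.replicate k b := by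
  classical
  have h0 : ∀ (c : A) (y : List A), (∃ k, c :: y = List.replicate k b) ↔
      c = b ∧ ∃ k, y = List.replicate k b := fun c y => by
    constructor
    · rintro ⟨_ | k, h⟩
      · simp at h
      · rw [List.replicate_succ, List.cons.injEq] at h
        exact ⟨h.1, k, h.2⟩
    · rintro ⟨rfl, k, rfl⟩
      exact ⟨k + 1, rfl⟩
  -- `some true`: both words have agreed so far; `some false`: the first word has ended and only
  -- letters `b` or padding may follow; `none`: failure.
  refine of_step₂ (P := fun s x y => match s with
    | none => False
    | some Bool.true => ∃ k, y = x ++ List.replicate k b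
    | some Bool.false => x = [] ∧ ∃ k, y = List.replicate k b) (fun s a c => match s with
    | none => none
    | some Bool.true => if c = a then some Bool.true else if a = none ∧ c = some b
        then some Bool.false else none
    | some Bool.false => if a = none ∧ (c = some b ∨ c = none) then some Bool.false else none)
    ?_ ?_ ?_ ?_ (some Bool.true) i j
  all_goals
    rintro (_ | _ | _) <;> intros <;> dsimp only <;> (try split_ifs) <;>
      simp_all

theorem length_lt (i j : ι) : Rec fun w : ι → List A => (w i).length < (w j).length := by
  refine of_step₂ (P := fun s x y => match s with
    | none => False
    | some Bool.true => True
    | some Bool.false => x.length < y.length) (fun s a b => match s with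
    | none => none
    | some Bool.true => some Bool.true
    | some Bool.false => if a.isNone then if b.isNone then some Bool.false else some Bool.true
        else if b.isNone then none else some Bool.false) ?_ ?_ ?_ ?_ (some Bool.false) i j
  all_goals
    rintro (_ | _ | _) <;> intros <;> simp

theorem length_eq (i j : ι) : Rec fun w : ι → List A => (w i).length = (w j).length :=
  ((length_lt i j).not.and (length_lt j i).not).congr fun _ => by omega

theorem lex_of_length_eq {r : A → A → Prop} (i j : ι) :
    Rec fun w : ι → List A => (w i).length = (w j).length ∧ List.Lex r (w i) (w j) := by
  classical
  -- `some false`: no difference so far; `some true`: the first difference was in favour of the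
  -- first word, and only the lengths remain to be compared; `none`: failure.
  refine of_step₂ (P := fun s x y => match s with
    | none => False
    | some Bool.true => x.length = y.length
    | some Bool.false => x.length = y.length ∧ List.Lex r x y) (fun s a b => match s, a, b with
    | none, _, _ => none
    | some Bool.true, some _, some _ => some Bool.true
    | some Bool.true, none, none => some Bool.true
    | some Bool.true, _, _ => none
    | some Bool.false, some a, some b => if r a b then some Bool.true else
      if a = b then some Bool.false else none
    | some Bool.false, none, none => some Bool.false
    | some Bool.false, _, _ => none) ?_ ?_ ?_ ?_ (some Bool.false) i j
  · rintro (_ | _ | _) a b x y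
    · simp
    · dsimp only
      split_ifs <;> simp_all [List.cons_lex_cons_iff]
    · simp
  all_goals
    rintro (_ | _ | _) <;> intros <;> simp

theorem shortlex {r : A → A → Prop} (i j : ι) :
    Rec fun w : ι → List A => List.Shortlex r (w i) (w j) :=
  ((length_lt i j).or (lex_of_length_eq i j)).congr fun _ => List.shortlex_def

end Rec

end FA

/-! ### Change of alphabet -/

namespace FA

open Turing

namespace Rec

/-- Relations over an alphabet remain recognizable after renaming the letters. -/
theorem map {C A ι : Type} [Finite ι] {P : (ι → List C) → Prop} (h : Rec P) (f : C → A) :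
    Rec fun w : ι → List A => ∃ u : ι → List C, (∀ i, w i = (u i).map f) ∧ P u := by
  obtain ⟨L, hL, h⟩ := h
  have pm : ∀ N (u : ι → List C),
      (padConv N u).map (fun l i => (l i).map f) = padConv N fun i => (u i).map f := by
    intro N u
    simp [padConv, Function.comp_def]
  refine ⟨_, isRegular_map (hL.inf (isRegular_range_padConv (A := C) (ι := ι)))
    fun l i => (l i).map f, fun w N hN => ?_⟩
  change (∃ x, (x ∈ L ∧ ∃ (N : ℕ) (w : ι → List C), (∀ i, (w i).length ≤ N) ∧
    padConv N w = x) ∧ x.map _ = _) ↔ _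
  constructor
  · rintro ⟨_, ⟨hx, M, u, hu, rfl⟩, e⟩
    have hM : M = N := by simpa [length_padConv] using congrArg List.length e
    subst hM
    rw [pm] at e
    have := padConv_injective (fun i => by simpa using hu i) hN e
    exact ⟨u, fun i => (congrFun this i).symm, (h _ _ hu).1 hx⟩
  · rintro ⟨u, hw, hu⟩
    obtain rfl : w = fun i => (u i).map f := funext hw
    have hu' : ∀ i, (u i).length ≤ N := fun i => by simpa using hN i
    exact ⟨_, ⟨(h u N hu').2 hu, N, u, hu', rfl⟩, pm N u⟩

/-- This transfers relations between binary expansions, or between descriptions of configurations,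
to the marked codes over the common alphabet. -/
theorem map_cons {C A ι : Type} [Finite A] [Finite ι] {D : List C → List C → Prop}
    (h : Rec fun w : Bool → List C => D (w Bool.false) (w Bool.true)) (f : C → A) (a b : A)
    (i j : ι) :
    Rec fun w : ι → List A => ∃ x y, w i = a :: x.map f ∧ w j = b :: y.map f ∧ D x y := by
  have h' : Rec fun w : Option (Option ι) → List A => ∃ u : Bool → List C,
      (∀ t : Bool, w (if t then none else some none) = (u t).map f) ∧ D (u false) (u true) :=
    (h.map f).comp _
  refine (ex (P := fun w u => ∃ v, (w i = a :: u ∧ w j = b :: v) ∧ ∃ x : Bool → List C,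
    (∀ t : Bool, (if t then v else u) = (x t).map f) ∧ D (x false) (x true))
    (ex (((eq_cons a (some none) (some (some i))).and
      (eq_cons b none (some (some j)))).and (h'.congr fun w => ?_)))).congr fun w => ?_
  · simp
  · constructor
    · rintro ⟨x, y, hx, hy, hD⟩
      exact ⟨_, _, ⟨hx, hy⟩, fun t => cond t y x, by simp, hD⟩
    · rintro ⟨u, v, ⟨hu, hv⟩, x, hx, hD⟩
      simp only [Bool.forall_bool, Bool.false_eq_true, if_false, if_true] at hx
      exact ⟨x false, x true, hx.1 ▸ hu, hx.2 ▸ hv, hD⟩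

theorem map_cons₁ {C A ι : Type} [Finite A] [Finite ι] {D : List C → Prop}
    (h : Rec fun w : Bool → List C => D (w Bool.true)) (f : C → A) (a : A) (i : ι) :
    Rec fun w : ι → List A => ∃ x, w i = a :: x.map f ∧ D x :=
  (map_cons (D := fun _ => D) h f a a i i).congr fun _ => by
    constructor
    · rintro ⟨x, hx, hD⟩
      exact ⟨x, x, hx, hx, hD⟩
    · rintro ⟨_, x, _, hx, hD⟩
      exact ⟨x, hx, hD⟩

end Rec

end FA

/-! ### Half-tapes, descriptions and configurations -/

namespace SquareAlgebra

open Turing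

variable {B Q : Type} [Inhabited B]

section Trim

theorem mk_append_replicate (l : List B) (n : ℕ) :
    ListBlank.mk (l ++ List.replicate n default) = ListBlank.mk l :=
  Quotient.sound' (Or.inr ⟨n, rfl⟩)

theorem exists_eq_trim_append (l : List B) :
    ∃ n, l = trim (ListBlank.mk l) ++ List.replicate n default := by
  classical
  change ∃ n, l = List.rdropWhile _ l ++ _
  induction l using List.reverseRecOn with
  | nil => exact ⟨0, rfl⟩
  | append_singleton l b ih =>
    by_cases hb : b = default
    · obtain ⟨n, hn⟩ := ih
      refine ⟨n + 1, ?_⟩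
      rw [List.rdropWhile_concat_pos _ _ _ (by simpa using hb), List.replicate_succ',
        ← List.append_assoc, ← hn, hb]
    · exact ⟨0, by rw [List.rdropWhile_concat_neg _ _ _ (by simpa using hb)]; simp⟩

theorem mk_trim (l : ListBlank B) : ListBlank.mk (trim l) = l := by
  induction l using ListBlank.induction_on with
  | _ l =>
    obtain ⟨n, hn⟩ := exists_eq_trim_append l
    conv_rhs => rw [hn, mk_append_replicate]

theorem getLast?_trim (l : ListBlank B) : (trim l).getLast? ≠ some default := by
  classical
  induction l using ListBlank.induction_on with
  | _ l =>
    change (List.rdropWhile _ l).getLast? ≠ _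
    induction l using List.reverseRecOn with
    | nil => simp
    | append_singleton l b ih =>
      by_cases hb : b = default
      · rwa [List.rdropWhile_concat_pos _ _ _ (by simpa using hb)]
      · rw [List.rdropWhile_concat_neg _ _ _ (by simpa using hb)]
        simpa using hb

theorem trim_mk {l : List B} (h : l.getLast? ≠ some default) : trim (ListBlank.mk l) = l := by
  obtain ⟨_ | n, hn⟩ := exists_eq_trim_append l
  · simpa using hn.symm
  · rw [List.replicate_succ', ← List.append_assoc] at hn
    rw [hn] at h
    simp at h

end Trim

/-- The word `l q r`. -/
def idWord (l : List B) (q : Q) (r : List B) : List (B ⊕ Q) :=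
  l.map Sum.inl ++ Sum.inr q :: r.map Sum.inl

omit [Inhabited B] in
theorem append_inr_cons_eq_idWord {p s : List (B ⊕ Q)} {q q' : Q} {l r : List B} :
    p ++ Sum.inr q :: s = idWord l q' r ↔
      p = l.map Sum.inl ∧ q = q' ∧ s = r.map Sum.inl := by
  constructor
  · intro h
    induction p generalizing l with
    | nil =>
      cases l with
      | nil => simpa [idWord] using h
      | cons b l => simp [idWord] at h
    | cons a p ih =>
      cases l with
      | nil =>
        simp only [idWord, List.map_nil, List.nil_append, List.cons_append, List.cons.injEq] at h
        have : Sum.inr q ∈ r.map (Sum.inl : B → B ⊕ Q) := by rw [← h.2]; simp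
        simp at this
      | cons b l =>
        simp only [idWord, List.map_cons, List.cons_append, List.cons.injEq] at h
        obtain ⟨rfl, h2, h3⟩ := ih h.2
        exact ⟨by rw [h.1]; rfl, h2, h3⟩
  · rintro ⟨rfl, rfl, rfl⟩
    rfl

omit [Inhabited B] in
theorem idWord_inj {l l' r r' : List B} {q q' : Q} :
    idWord l q r = idWord l' q' r' ↔ l = l' ∧ q = q' ∧ r = r' := by
  rw [idWord, append_inr_cons_eq_idWord]
  simp [List.map_inj_right Sum.inl_injective]

omit [Inhabited B] in
theorem inl_cons_idWord (b : B) (l : List B) (q : Q) (r : List B) :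
    Sum.inl b :: idWord l q r = idWord (b :: l) q r := rfl

omit [Inhabited B] in
theorem idWord_append (l : List B) (q : Q) (r : List B) (n : ℕ) (b : B) :
    idWord l q r ++ List.replicate n (Sum.inl b) = idWord l q (r ++ List.replicate n b) := by
  simp [idWord]

namespace Config

/-- The configuration with state `q`, the word `l` to the left of the head, and the word `r` from
the head rightwards, all other cells being blank. -/
def ofLists (l : List B) (q : Q) (r : List B) : Config B Q :=
  ⟨q, Tape.mk' (ListBlank.mk l.reverse) (ListBlank.mk r)⟩

theorem left_ofLists_eq_trim (l : List B) (q : Q) (r : List B) :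
    (ofLists l q r).left = (trim (ListBlank.mk l.reverse)).reverse := rfl

theorem right_ofLists_eq_trim (l : List B) (q : Q) (r : List B) :
    (ofLists l q r).right = trim (ListBlank.mk r) :=
  congrArg trim (Tape.mk'_right₀ _ _)

theorem left_ofLists {l : List B} (h : l.head? ≠ some default) (q : Q) (r : List B) :
    (ofLists l q r).left = l := by
  rw [left_ofLists_eq_trim, trim_mk (by simpa using h), List.reverse_reverse]

theorem right_ofLists {r : List B} (h : r.getLast? ≠ some default) (l : List B) (q : Q) :
    (ofLists l q r).right = r := by
  rw [right_ofLists_eq_trim, trim_mk h]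

theorem ofLists_left_right (c : Config B Q) : ofLists c.left c.state c.right = c := by
  obtain ⟨q, t⟩ := c
  simp only [ofLists, left, right, List.reverse_reverse, mk_trim]
  congr
  exact Tape.mk'_left_right₀ t

theorem head?_left (c : Config B Q) : c.left.head? ≠ some default := by
  rw [left, List.head?_reverse]
  exact getLast?_trim _

theorem getLast?_right (c : Config B Q) : c.right.getLast? ≠ some default :=
  getLast?_trim _

theorem word_eq (c : Config B Q) : c.word = idWord c.left c.state c.right := rfl

theorem word_injective : Function.Injective (word : Config B Q → List (B ⊕ Q)) := by
  intro c d h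
  obtain ⟨h1, h2, h3⟩ := idWord_inj.1 h
  rw [← ofLists_left_right c, ← ofLists_left_right d, h1, h2, h3]

theorem word_ofLists {l r : List B} (hl : l.head? ≠ some default)
    (hr : r.getLast? ≠ some default) (q : Q) : (ofLists l q r).word = idWord l q r := by
  rw [word_eq, left_ofLists hl, right_ofLists hr]
  rfl

theorem ofLists_blank_cons (l : List B) (q : Q) (r : List B) :
    ofLists (default :: l) q r = ofLists l q r := by
  rw [ofLists, List.reverse_cons, ← List.replicate_one, mk_append_replicate]
  rfl

theorem ofLists_append_blank (l : List B) (q : Q) (r : List B) (n : ℕ) :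
    ofLists l q (r ++ List.replicate n default) = ofLists l q r := by
  rw [ofLists, mk_append_replicate]
  rfl

/-- An untrimmed description consists of the description and blanks at both ends. -/
theorem exists_idWord_eq (l : List B) (q : Q) (r : List B) :
    ∃ m n, idWord l q r = List.replicate m (Sum.inl default) ++ ((ofLists l q r).word ++
        List.replicate n (Sum.inl default)) ∧
      l = List.replicate m default ++ (ofLists l q r).left := by
  obtain ⟨m, hm⟩ := exists_eq_trim_append l.reverse
  obtain ⟨n, hn⟩ := exists_eq_trim_append r
  have hl : l = List.replicate m default ++ (ofLists l q r).left := by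
    rw [left_ofLists_eq_trim]
    conv_lhs => rw [← List.reverse_reverse l, hm]
    simp
  refine ⟨m, n, ?_, hl⟩
  rw [word_eq, idWord_append, right_ofLists_eq_trim, ← hn]
  conv_lhs => rw [hl]
  simp [idWord, ofLists]

end Config

namespace Machine

variable (T : Machine B Q)

theorem step_ofLists_right {q q' : Q} {b b' : B} (h : T.trans q b = (q', b', Dir.right))
    (l r : List B) :
    T.step (Config.ofLists l q (b :: r)) = Config.ofLists (l ++ [b']) q' r := by
  simp [step, Config.ofLists, h, ListBlank.cons_mk]

theorem step_ofLists_left {q q' : Q} {b b' : B} (h : T.trans q b = (q', b', Dir.left))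
    (l r : List B) (d : B) :
    T.step (Config.ofLists (l ++ [d]) q (b :: r)) = Config.ofLists l q' (d :: b' :: r) := by
  simp [step, Config.ofLists, h, ListBlank.cons_mk]

end Machine

end SquareAlgebra

namespace SquareAlgebra

open Turing FA

variable {B Q : Type} [Inhabited B]

/-! ### Recognizing descriptions and outputs -/

section Words

/-- `x` is the description of a configuration with state `q` and tape contents `a ^ k`. -/
theorem outputs_iff (T : Machine B Q) (c : Config B Q) (k : ℕ) :
    T.Outputs c k ↔ ∃ m n, m + n = k ∧
      c.word = idWord (List.replicate m T.a) T.sq (List.replicate n T.a) := by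
  simp only [Machine.Outputs, Config.contents, Config.word_eq, idWord_inj,
    List.append_eq_replicate_iff]
  constructor
  · rintro ⟨h, h1, h2, h3⟩
    exact ⟨_, _, h1, h2, h, h3⟩
  · rintro ⟨m, n, rfl, h2, h, h3⟩
    refine ⟨h, ?_, ?_, ?_⟩ <;> simp [h2, h3]

theorem rec_word [Finite B] [Finite Q] {ι : Type} [Finite ι] (i : ι) :
    Rec fun w : ι → List (B ⊕ Q) => ∃ c : Config B Q, w i = c.word := by
  classical
  -- State 0 precedes the state letter. After it, 1 and 2 record whether the word may end now or the
  -- last symbol was a blank, so that more must follow; 3 is failure. A blank at the beginning of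
  -- the left part is excluded separately, by the second conjunct in the final step.
  let P (s : Fin 4) (x : List (B ⊕ Q)) : Prop := match s with
    | 0 => ∃ l q r, x = idWord l q r ∧ r.getLast? ≠ some default
    | 1 => ∃ r : List B, x = r.map Sum.inl ∧ r.getLast? ≠ some default
    | 2 => ∃ r : List B, x = r.map Sum.inl ∧ r ≠ [] ∧ r.getLast? ≠ some default
    | 3 => False
  let step (s : Fin 4) (a : Option (B ⊕ Q)) : Fin 4 := match s, a with
    | 0, some (Sum.inl _) => 0
    | 0, some (Sum.inr _) => 1
    | 1, some (Sum.inl b) => if b = default then 2 else 1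
    | 2, some (Sum.inl b) => if b = default then 2 else 1
    | 1, none => 1
    | _, _ => 3
  have tail (b : B) (x : List (B ⊕ Q)) : (∃ r : List B, Sum.inl b :: x = r.map Sum.inl ∧
      r.getLast? ≠ some default) ↔ P (if b = default then 2 else 1) x := by
    constructor
    · rintro ⟨_ | ⟨b, r⟩, h, hr⟩
      · simp at h
      · simp only [List.map_cons, List.cons.injEq, Sum.inl.injEq] at h
        obtain ⟨rfl, rfl⟩ := h
        split_ifs with hb
        · refine ⟨r, rfl, ?_, ?_⟩ <;> cases r <;> simp_all
        · refine ⟨r, rfl, ?_⟩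
          cases r <;> simp_all
    · split_ifs with hb
      · rintro ⟨r, rfl, h0, hr⟩
        refine ⟨b :: r, rfl, ?_⟩
        cases r <;> simp_all
      · rintro ⟨r, rfl, hr⟩
        refine ⟨b :: r, rfl, ?_⟩
        cases r <;> simp_all
  have main : Rec fun w : ι → List (B ⊕ Q) => P 0 (w i) := by
    refine Rec.of_step₁ (P := P) step ?_ ?_ 0 i
    · intro s a x
      match s, a with
      | 0, Sum.inl b =>
        constructor
        · rintro ⟨_ | ⟨b, l⟩, q, r, h, hr⟩
          · simp [idWord] at h
          · exact ⟨l, q, r, (List.cons.inj h).2, hr⟩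
        · rintro ⟨l, q, r, rfl, hr⟩
          exact ⟨b :: l, q, r, rfl, hr⟩
      | 0, Sum.inr q =>
        constructor
        · rintro ⟨_ | ⟨b, l⟩, q, r, h, hr⟩
          · exact ⟨r, (List.cons.inj h).2, hr⟩
          · simp [idWord] at h
        · rintro ⟨r, rfl, hr⟩
          exact ⟨[], q, r, rfl, hr⟩
      | 1, Sum.inl b => exact tail b x
      | 2, Sum.inl b =>
        refine Iff.trans ?_ (tail b x)
        constructor
        · rintro ⟨r, h, -, hr⟩
          exact ⟨r, h, hr⟩
        · rintro ⟨r, h, hr⟩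
          refine ⟨r, h, ?_, hr⟩
          rintro rfl
          simp at h
      | 1, Sum.inr q | 2, Sum.inr q =>
        refine iff_of_false ?_ id
        rintro ⟨_ | ⟨b, l⟩, h, -⟩ <;> simp at h
      | 3, _ => exact Iff.rfl
    · intro s
      match s with
      | 0 =>
        refine iff_of_false ?_ id
        rintro ⟨l, q, r, h, -⟩
        simp [idWord] at h
      | 1 => exact Iff.rfl
      | 2 =>
        refine iff_of_false ?_ id
        rintro ⟨r, h, h', -⟩
        exact h' (by simpa using h.symm)
      | 3 => exact Iff.rfl
  refine (main.and (Rec.ex (P := fun w v => w i = Sum.inl default :: v)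
    (Rec.eq_cons (Sum.inl default) none (some i))).not).congr fun w => ?_
  constructor
  · rintro ⟨c, hc⟩
    refine ⟨⟨_, _, _, hc, c.getLast?_right⟩, ?_⟩
    rintro ⟨v, hv⟩
    have := c.head?_left
    rw [hc, Config.word_eq] at hv
    cases h : c.left <;> simp_all [idWord]
  · rintro ⟨⟨l, q, r, h, hr⟩, h'⟩
    refine ⟨Config.ofLists l q r, ?_⟩
    rw [Config.word_ofLists ?_ hr, h]
    intro hl
    obtain ⟨l', rfl⟩ : ∃ l', l = default :: l' := by cases l <;> simp_all
    exact h' ⟨idWord l' q r, h⟩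

theorem rec_outputs [Finite B] [Finite Q] (T : Machine B Q) {ι : Type} [Finite ι] (i : ι) :
    Rec fun w : ι → List (B ⊕ Q) => ∃ m n,
      w i = idWord (List.replicate m T.a) T.sq (List.replicate n T.a) := by
  classical
  let P (s : Fin 3) (x : List (B ⊕ Q)) : Prop := match s with
    | 0 => ∃ m n, x = idWord (List.replicate m T.a) T.sq (List.replicate n T.a)
    | 1 => ∃ n, x = List.replicate n (Sum.inl T.a)
    | 2 => False
  let step (s : Fin 3) (a : Option (B ⊕ Q)) : Fin 3 := match s with
    | 0 => if a = some (Sum.inl T.a) then 0 else if a = some (Sum.inr T.sq) then 1 else 2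
    | 1 => if a = some (Sum.inl T.a) ∨ a = none then 1 else 2
    | 2 => 2
  refine Rec.of_step₁ (P := P) step ?_ ?_ 0 i
  · intro s a x
    match s with
    | 0 =>
      change _ ↔ P (if _ then _ else _) x
      split_ifs with h h'
      · obtain rfl := Option.some.inj h
        constructor
        · rintro ⟨_ | m, n, h⟩
          · simp [idWord] at h
          · exact ⟨m, n, (List.cons.inj h).2⟩
        · rintro ⟨m, n, rfl⟩
          exact ⟨m + 1, n, rfl⟩
      · obtain rfl := Option.some.inj h'
        constructor
        · rintro ⟨_ | m, n, h⟩
          · exact ⟨n, by simpa [idWord] using h⟩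
          · simp [idWord, List.replicate_succ] at h
        · rintro ⟨n, rfl⟩
          exact ⟨0, n, by simp [idWord]⟩
      · refine iff_of_false ?_ id
        rintro ⟨_ | m, n, e⟩
        · simp [idWord] at e
          exact h' (by rw [e.1])
        · simp [idWord, List.replicate_succ] at e
          exact h (by rw [e.1])
    | 1 =>
      change _ ↔ P (if _ then _ else _) x
      by_cases h : a = Sum.inl T.a
      · subst h
        rw [if_pos (Or.inl rfl)]
        constructor
        · rintro ⟨_ | n, h⟩
          · simp at h
          · exact ⟨n, (List.cons.inj h).2⟩
        · rintro ⟨n, rfl⟩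
          exact ⟨n + 1, rfl⟩
      · rw [if_neg (by simpa using h)]
        refine iff_of_false ?_ id
        rintro ⟨_ | n, e⟩
        · simp at e
        · exact h (List.cons.inj e).1
    | 2 => exact Iff.rfl
  · intro s
    match s with
    | 0 =>
      refine iff_of_false ?_ id
      rintro ⟨m, n, h⟩
      simp [idWord] at h
    | 1 => exact Iff.rfl
    | 2 => exact Iff.rfl

end Words

/-! ### The local rewriting relation of a computation step -/

section Move

/-- One computation step on untrimmed descriptions. -/
def Move (T : Machine B Q) (x y : List (B ⊕ Q)) : Prop :=
  (∃ p s q q' b b', T.trans q b = (q', b', Dir.right) ∧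
    x = p ++ Sum.inr q :: Sum.inl b :: s ∧ y = p ++ Sum.inl b' :: Sum.inr q' :: s) ∨
  ∃ p s q q' b b' d, T.trans q b = (q', b', Dir.left) ∧
    x = p ++ Sum.inl d :: Sum.inr q :: Sum.inl b :: s ∧
    y = p ++ Sum.inr q' :: Sum.inl d :: Sum.inl b' :: s

/-- The states of an automaton that recognizes the relation `Move T`. -/
inductive MoveState (B Q : Type) : Type
  | copy
  | right (q : Q) (b : B)
  | left (d : B) (q : Q)
  | left' (q q' : Q)
  | same
  | dead

instance [Finite B] [Finite Q] : Finite (MoveState B Q) := by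
  let f : MoveState B Q → Option ((Q × B ⊕ B × Q) ⊕ Q × Q ⊕ Bool) := fun s => match s with
    | .copy => none
    | .right q b => some (.inl (.inl (q, b)))
    | .left d q => some (.inl (.inr (d, q)))
    | .left' q q' => some (.inr (.inl (q, q')))
    | .same => some (.inr (.inr true))
    | .dead => some (.inr (.inr false))
  refine Finite.of_injective f ?_
  rintro (_ | _ | _ | _ | _ | _) (_ | _ | _ | _ | _ | _) h <;> simp_all [f]

/-- The relation that an automaton for `Move T` has still to verify in each of its states. -/
def MoveState.Rel (T : Machine B Q) (σ : MoveState B Q) (x y : List (B ⊕ Q)) : Prop :=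
  match σ with
  | copy => Move T x y
  | right q b' => ∃ b q' s, T.trans q b = (q', b', Dir.right) ∧
      x = Sum.inl b :: s ∧ y = Sum.inr q' :: s
  | left d q' => ∃ b b' q s, T.trans q b = (q', b', Dir.left) ∧
      x = Sum.inr q :: Sum.inl b :: s ∧ y = Sum.inl d :: Sum.inl b' :: s
  | left' q q' => ∃ b b' s, T.trans q b = (q', b', Dir.left) ∧
      x = Sum.inl b :: s ∧ y = Sum.inl b' :: s
  | same => x = y
  | dead => False

open Classical in
/-- The transition function of an automaton for `Move T`. -/
noncomputable def MoveState.step (T : Machine B Q) (σ : MoveState B Q) (x y : Option (B ⊕ Q)) :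
    MoveState B Q :=
  match σ, x, y with
  | copy, some (.inr q), some (.inl b) => right q b
  | copy, some (.inl d), some (.inr q) => left d q
  | copy, some a, some a' => if a = a' then copy else dead
  | right q b', some (.inl b), some (.inr q') =>
      if T.trans q b = (q', b', Dir.right) then same else dead
  | left d q', some (.inr q), some (.inl d') => if d = d' then left' q q' else dead
  | left' q q', some (.inl b), some (.inl b') =>
      if T.trans q b = (q', b', Dir.left) then same else dead
  | same, a, a' => if a = a' then same else dead
  | _, _, _ => dead

theorem move_nil_left (T : Machine B Q) (y : List (B ⊕ Q)) : ¬ Move T [] y := by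
  rintro (⟨p, s, q, q', b, b', -, h, -⟩ | ⟨p, s, q, q', b, b', d, -, h, -⟩) <;> simp at h

theorem move_nil_right (T : Machine B Q) (x : List (B ⊕ Q)) : ¬ Move T x [] := by
  rintro (⟨p, s, q, q', b, b', -, -, h⟩ | ⟨p, s, q, q', b, b', d, -, -, h⟩) <;> simp at h

theorem move_cons_cons (T : Machine B Q) (a a' : B ⊕ Q) (x y : List (B ⊕ Q)) :
    Move T (a :: x) (a' :: y) ↔ a = a' ∧ Move T x y ∨
      (∃ q b', a = Sum.inr q ∧ a' = Sum.inl b' ∧ (MoveState.right q b').Rel T x y) ∨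
      ∃ d q', a = Sum.inl d ∧ a' = Sum.inr q' ∧ (MoveState.left d q').Rel T x y := by
  constructor
  · rintro (⟨_ | ⟨c, p⟩, s, q, q', b, b', h, h1, h2⟩ | ⟨_ | ⟨c, p⟩, s, q, q', b, b', d, h, h1, h2⟩)
    · obtain ⟨rfl, rfl⟩ := List.cons.inj h1
      obtain ⟨rfl, rfl⟩ := List.cons.inj h2
      exact Or.inr (Or.inl ⟨q, b', rfl, rfl, b, q', s, h, rfl, rfl⟩)
    · obtain ⟨rfl, rfl⟩ := List.cons.inj h1
      obtain ⟨rfl, rfl⟩ := List.cons.inj h2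
      exact Or.inl ⟨rfl, Or.inl ⟨p, s, q, q', b, b', h, rfl, rfl⟩⟩
    · obtain ⟨rfl, rfl⟩ := List.cons.inj h1
      obtain ⟨rfl, rfl⟩ := List.cons.inj h2
      exact Or.inr (Or.inr ⟨d, q', rfl, rfl, b, b', q, s, h, rfl, rfl⟩)
    · obtain ⟨rfl, rfl⟩ := List.cons.inj h1
      obtain ⟨rfl, rfl⟩ := List.cons.inj h2
      exact Or.inl ⟨rfl, Or.inr ⟨p, s, q, q', b, b', d, h, rfl, rfl⟩⟩
  · rintro (⟨rfl, ⟨p, s, q, q', b, b', h, rfl, rfl⟩ | ⟨p, s, q, q', b, b', d, h, rfl, rfl⟩⟩ |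
      ⟨q, b', rfl, rfl, b, q', s, h, rfl, rfl⟩ | ⟨d, q', rfl, rfl, b, b', q, s, h, rfl, rfl⟩)
    · exact Or.inl ⟨a :: p, s, q, q', b, b', h, rfl, rfl⟩
    · exact Or.inr ⟨a :: p, s, q, q', b, b', d, h, rfl, rfl⟩
    · exact Or.inl ⟨[], s, q, q', b, b', h, rfl, rfl⟩
    · exact Or.inr ⟨[], s, q, q', b, b', d, h, rfl, rfl⟩

/-- Outside a window of at most three letters around the state letter both words agree position by
position; the automaton copies, verifies the window while remembering the letters involved, and
copies again. -/
theorem rec_move [Finite B] [Finite Q] (T : Machine B Q) {ι : Type} (i j : ι) :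
    Rec fun w : ι → List (B ⊕ Q) => Move T (w i) (w j) := by
  refine Rec.of_step₂ (P := MoveState.Rel T) (MoveState.step T) ?_ ?_ ?_ ?_ MoveState.copy i j
  · rintro (_ | ⟨q, b⟩ | ⟨d, q⟩ | ⟨q, q'⟩ | _ | _) (a | a) (a' | a') x y <;>
      simp only [MoveState.step] <;> (try split_ifs) <;>
      simp_all [MoveState.Rel, move_cons_cons] <;> grind
  · rintro (_ | ⟨q, b⟩ | ⟨d, q⟩ | ⟨q, q'⟩ | _ | _) (a | a) x <;>
      simp [MoveState.step, MoveState.Rel, move_nil_right]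
  · rintro (_ | ⟨q, b⟩ | ⟨d, q⟩ | ⟨q, q'⟩ | _ | _) (a | a) x <;>
      simp [MoveState.step, MoveState.Rel, move_nil_left]
  · rintro (_ | ⟨q, b⟩ | ⟨d, q⟩ | ⟨q, q'⟩ | _ | _) <;>
      simp [MoveState.step, MoveState.Rel, move_nil_left]

end Move

end SquareAlgebra

namespace SquareAlgebra

open Turing FA

variable {B Q : Type} [Inhabited B]

/-! ### Computation steps on trimmed descriptions -/

section Step

/-- A description contains a single state letter, which forces the position of the window in `Move`.
-/
theorem idWord_of_move {T : Machine B Q} {l r : List B} {q : Q} {y : List (B ⊕ Q)}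
    (h : Move T (idWord l q r) y) :
    ∃ l' q' r', y = idWord l' q' r' ∧ T.step (Config.ofLists l q r) = Config.ofLists l' q' r' := by
  rcases h with ⟨p, s, q₀, q', b, b', h, hx, rfl⟩ | ⟨p, s, q₀, q', b, b', d, h, hx, rfl⟩
  · obtain ⟨rfl, rfl, hs⟩ := append_inr_cons_eq_idWord.1 hx.symm
    obtain ⟨b₀, r, rfl, hb, rfl⟩ := List.map_eq_cons_iff.1 hs.symm
    obtain rfl := Sum.inl_injective hb
    exact ⟨_, _, _, by simp [idWord], T.step_ofLists_right h l r⟩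
  · rw [List.append_cons] at hx
    obtain ⟨hp, rfl, hs⟩ := append_inr_cons_eq_idWord.1 hx.symm
    obtain ⟨b₀, r, rfl, hb, rfl⟩ := List.map_eq_cons_iff.1 hs.symm
    obtain rfl := Sum.inl_injective hb
    obtain ⟨l, _, rfl, rfl, hd⟩ := List.map_eq_append_iff.1 hp.symm
    obtain ⟨d₀, l', rfl, hd, hl⟩ := List.map_eq_cons_iff.1 hd
    obtain rfl := Sum.inl_injective hd
    obtain rfl := List.map_eq_nil_iff.1 hl
    exact ⟨_, _, _, by simp [idWord], T.step_ofLists_left h l r d₀⟩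

/-- One blank at both ends of a description is enough room for a computation step, which leaves
at most two superfluous blanks at the left end. -/
theorem exists_move (T : Machine B Q) (c : Config B Q) :
    ∃ l' q' r', Move T (idWord (default :: c.left) c.state (c.right ++ [default]))
        (idWord l' q' r') ∧ T.step c = Config.ofLists l' q' r' ∧
      ∀ t, l' ≠ default :: default :: default :: t := by
  obtain ⟨b, r, hr⟩ : ∃ b r, c.right ++ [default] = b :: r := by
    cases h : c.right <;> simp
  have hc : c = Config.ofLists (default :: c.left) c.state (b :: r) := by
    rw [Config.ofLists_blank_cons, ← hr, ← List.replicate_one, Config.ofLists_append_blank,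
      Config.ofLists_left_right]
  have hl := c.head?_left
  rw [hr]
  rcases h : T.trans c.state b with ⟨q', b', _ | _⟩
  · obtain ⟨l, d, hd⟩ : ∃ l d, default :: c.left = l ++ [d] :=
      ⟨_, _, (List.dropLast_append_getLast (List.cons_ne_nil _ _)).symm⟩
    refine ⟨l, q', d :: b' :: r, Or.inr ⟨l.map Sum.inl, r.map Sum.inl, c.state, q', b, b', d, h,
      ?_, ?_⟩, ?_, ?_⟩
    · rw [hd]
      simp [idWord]
    · simp [idWord]
    · conv_lhs => rw [hc, hd]
      exact T.step_ofLists_left h l r d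
    · rintro t rfl
      simp only [List.cons_append, List.cons.injEq] at hd
      rw [hd.2] at hl
      exact hl rfl
  · refine ⟨default :: c.left ++ [b'], q', r, Or.inl ⟨(default :: c.left).map Sum.inl,
      r.map Sum.inl, c.state, q', b, b', h, ?_, ?_⟩, ?_, ?_⟩
    · simp [idWord]
    · simp [idWord]
    · conv_lhs => rw [hc]
      exact T.step_ofLists_right h _ r
    · intro t ht
      rw [List.cons_append, List.cons.injEq] at ht
      rcases h : c.left with _ | ⟨d, l⟩
      · rw [h] at ht
        simp at ht
      · rw [h] at ht hl
        simp only [List.cons_append, List.cons.injEq] at ht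
        exact hl (by rw [ht.2.1]; rfl)

/-- `Move` needs a cell on each side of the head, and its result may have blanks at the ends. One
blank is added on the left and any number on the right. Afterwards up to two blanks are dropped on
the left: two occur when the head had nothing but blanks to its left, wrote a blank and moved right.
For the converse, blanks at the ends do not change the configuration. -/
theorem word_step_iff (T : Machine B Q) (c d : Config B Q) :
    d = T.step c ↔ ∃ x y, (∃ k, x = (Sum.inl default :: c.word) ++
      List.replicate k (Sum.inl default)) ∧ Move T x y ∧
      ((∃ k, y = d.word ++ List.replicate k (Sum.inl default)) ∨
        (∃ k, y = (Sum.inl default :: d.word) ++ List.replicate k (Sum.inl default)) ∨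
        ∃ k, y = (Sum.inl default :: Sum.inl default :: d.word) ++
          List.replicate k (Sum.inl default)) := by
  constructor
  · rintro rfl
    obtain ⟨l, q, r, h, hs, hl⟩ := exists_move T c
    refine ⟨_, _, ⟨1, ?_⟩, h, ?_⟩
    · simp [Config.word_eq, idWord]
    · obtain ⟨m, n, hmn, hlm⟩ := Config.exists_idWord_eq l q r
      rw [hs]
      match m with
      | 0 => exact Or.inl ⟨n, hmn⟩
      | 1 => exact Or.inr (Or.inl ⟨n, hmn⟩)
      | 2 => exact Or.inr (Or.inr ⟨n, hmn⟩)
      | m + 3 => exact absurd hlm (hl _)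
  · rintro ⟨_, y, ⟨k, rfl⟩, h, hy⟩
    rw [Config.word_eq, inl_cons_idWord, idWord_append] at h
    obtain ⟨l, q, r, rfl, hs⟩ := idWord_of_move h
    rw [Config.ofLists_blank_cons, Config.ofLists_append_blank, Config.ofLists_left_right] at hs
    rw [hs]
    simp only [Config.word_eq, inl_cons_idWord, idWord_append, idWord_inj] at hy
    rcases hy with ⟨k, rfl, rfl, rfl⟩ | ⟨k, rfl, rfl, rfl⟩ | ⟨k, rfl, rfl, rfl⟩ <;>
      simp only [Config.ofLists_blank_cons, Config.ofLists_append_blank, Config.ofLists_left_right]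

theorem rec_step [Finite B] [Finite Q] (T : Machine B Q) {ι : Type} [Finite ι] (i j : ι) :
    Rec fun w : ι → List (B ⊕ Q) => ∃ c : Config B Q, w i = c.word ∧ w j = (T.step c).word := by
  let b : B ⊕ Q := Sum.inl default
  -- The auxiliary words `u`, `v₁`, `v₂` serve to prefix blanks one at a time, by `Rec.eq_cons`.
  have key : Rec fun w : ι → List (B ⊕ Q) => ∃ x y u v₁ v₂,
      (u = b :: w i ∧ v₁ = b :: w j ∧ v₂ = b :: v₁) ∧ (∃ k, x = u ++ List.replicate k b) ∧
      Move T x y ∧ ((∃ k, y = w j ++ List.replicate k b) ∨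
        (∃ k, y = v₁ ++ List.replicate k b) ∨ ∃ k, y = v₂ ++ List.replicate k b) := by
    iterate 5 refine Rec.ex ?_
    exact ((Rec.eq_cons _ _ _).and ((Rec.eq_cons _ _ _).and (Rec.eq_cons _ _ _))).and
      ((Rec.exists_eq_append_replicate _ _ _).and ((rec_move T _ _).and
        ((Rec.exists_eq_append_replicate _ _ _).or
          ((Rec.exists_eq_append_replicate _ _ _).or (Rec.exists_eq_append_replicate _ _ _)))))
  refine (((rec_word i).and (rec_word j)).and key).congr fun w => ?_
  constructor
  · rintro ⟨c, hi, hj⟩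
    obtain ⟨x, y, hx, h, hy⟩ := (word_step_iff T c _).1 rfl
    rw [← hi] at hx
    rw [← hj] at hy
    exact ⟨⟨⟨c, hi⟩, _, hj⟩, x, y, _, _, _, ⟨rfl, rfl, rfl⟩, hx, h, hy⟩
  · rintro ⟨⟨⟨c, hi⟩, d, hj⟩, x, y, _, _, _, ⟨rfl, rfl, rfl⟩, hx, h, hy⟩
    rw [hi] at hx
    rw [hj] at hy
    obtain rfl := (word_step_iff T c d).2 ⟨x, y, hx, h, hy⟩
    exact ⟨c, hi, hj⟩

end Step

/-! ### The successor in the length-plus-lexicographic order -/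

section Order

variable {ord : LinearOrder (B ⊕ Q)}

theorem Precedes.trans {c d e : Config B Q} (h : Precedes ord c d) (h' : Precedes ord d e) :
    Precedes ord c e := by
  let _ := ord
  unfold Precedes at *
  rw [List.shortlex_def] at *
  rcases h with h | ⟨h1, h2⟩ <;> rcases h' with h' | ⟨h1', h2'⟩
  · exact Or.inl (h.trans h')
  · exact Or.inl (h1' ▸ h)
  · exact Or.inl (h1 ▸ h')
  · exact Or.inr ⟨h1.trans h1', lt_trans (α := List (B ⊕ Q)) h2 h2'⟩

theorem Precedes.irrefl (c : Config B Q) : ¬ Precedes ord c c := by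
  let _ := ord
  unfold Precedes
  rw [List.shortlex_def]
  rintro (h | ⟨-, h⟩)
  · exact lt_irrefl _ h
  · exact lt_irrefl (α := List (B ⊕ Q)) _ h

theorem Precedes.trichotomy (ord : LinearOrder (B ⊕ Q)) (c d : Config B Q) :
    Precedes ord c d ∨ c = d ∨ Precedes ord d c := by
  let _ := ord
  exact (shortlex_trichotomy c.word d.word).imp id (Or.imp (fun h => Config.word_injective h) id)

theorem Precedes.length_le {c d : Config B Q} (h : Precedes ord c d) :
    c.word.length ≤ d.word.length := by
  rcases List.shortlex_def.1 h with h | ⟨h, -⟩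
  · exact h.le
  · exact h.le

variable [Finite B] [Finite Q]

theorem Precedes.wellFounded (ord : LinearOrder (B ⊕ Q)) :
    WellFounded (Precedes ord : Config B Q → Config B Q → Prop) := by
  let _ := ord
  exact InvImage.wf Config.word (List.Shortlex.wf (wellFounded_lt (α := B ⊕ Q)))

/-- Appending the non-blank symbol `a` gives a longer description, so some configuration lies above
`c`; by well-foundedness there is a least one, and by trichotomy it is the next one. -/
theorem isNext_next (ord : LinearOrder (B ⊕ Q)) {a : B} (ha : a ≠ default) (c : Config B Q) :
    IsNext ord c (next ord c) := by
  classical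
  have hne : {d | Precedes ord c d}.Nonempty := by
    refine ⟨Config.ofLists c.left c.state (c.right ++ [a]), List.shortlex_def.2 (Or.inl ?_)⟩
    rw [Config.word_ofLists c.head?_left (by simpa using ha), Config.word_eq]
    simp [idWord]
  have hex : ∃ d, IsNext ord c d := by
    refine ⟨(Precedes.wellFounded ord).min _ hne, (Precedes.wellFounded ord).min_mem _ hne,
      fun e he => ?_⟩
    rcases Precedes.trichotomy ord e ((Precedes.wellFounded ord).min _ hne) with h | h | h
    · exact absurd h ((Precedes.wellFounded ord).not_lt_min _ he)
    · exact Or.inl h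
    · exact Or.inr h
  rw [next, dif_pos hex]
  exact hex.choose_spec

omit [Finite B] [Finite Q] in
theorem IsNext.unique {c d d' : Config B Q} (h : IsNext ord c d) (h' : IsNext ord c d') :
    d = d' := by
  rcases h.2 d' h'.1 with e | e
  · exact e.symm
  · rcases h'.2 d h.1 with e' | e'
    · exact e'
    · exact absurd (e.trans e') (Precedes.irrefl _)

/-- The successor is first-order definable from the order, with quantification restricted to words
that are descriptions. -/
theorem rec_next (ord : LinearOrder (B ⊕ Q)) {a : B} (ha : a ≠ default) {ι : Type} [Finite ι]
    (i j : ι) :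
    Rec fun w : ι → List (B ⊕ Q) => ∃ c : Config B Q, w i = c.word ∧ w j = (next ord c).word := by
  have key : Rec fun w : ι → List (B ⊕ Q) => ((∃ c : Config B Q, w i = c.word) ∧
      ∃ c : Config B Q, w j = c.word) ∧ List.Shortlex ord.lt (w i) (w j) ∧
      ∀ v, (∃ c : Config B Q, v = c.word) → List.Shortlex ord.lt (w i) v →
        v = w j ∨ List.Shortlex ord.lt (w j) v :=
    ((rec_word i).and (rec_word j)).and ((Rec.shortlex i j).and (Rec.all ((rec_word _).imp
      ((Rec.shortlex _ _).imp ((Rec.eq _ _).or (Rec.shortlex _ _))))))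
  refine key.congr fun w => ?_
  constructor
  · rintro ⟨c, hi, hj⟩
    obtain ⟨h1, h2⟩ := isNext_next ord ha c
    rw [hi, hj]
    refine ⟨⟨⟨c, rfl⟩, _, rfl⟩, h1, ?_⟩
    rintro _ ⟨e, rfl⟩ he
    exact (h2 e he).imp (congrArg _) id
  · rintro ⟨⟨⟨c, hi⟩, d, hj⟩, h1, h2⟩
    rw [hi, hj] at h1 h2
    have : IsNext ord c d :=
      ⟨h1, fun e he => (h2 _ ⟨e, rfl⟩ he).imp (fun h => Config.word_injective h) id⟩
    obtain rfl := this.unique (isNext_next ord ha c)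
    exact ⟨c, hi, hj⟩

end Order

end SquareAlgebra

/-! ### Presentations from injective codings -/

namespace FA

open FirstOrder

namespace Rec

variable {A ι κ : Type}

theorem forall_mem (s : Finset κ) {P : κ → (ι → List A) → Prop} (h : ∀ k, Rec (P k)) :
    Rec fun w => ∀ k ∈ s, P k w := by
  classical
  induction s using Finset.induction_on with
  | empty =>
    exact of_step (S := Unit) (P := fun _ _ => True) (fun _ _ => ()) (by simp) () |>.congr (by simp)
  | insert k s _ ih => exact ((h k).and ih).congr fun w => by simp

theorem forall_finite [Finite κ] {P : κ → (ι → List A) → Prop} (h : ∀ k, Rec (P k)) :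
    Rec fun w => ∀ k, P k w := by
  have := Fintype.ofFinite κ
  exact (forall_mem Finset.univ h).congr fun w => by simp

end Rec

/-- A structure with an injective coding of its elements by words is presentable if the set of
codes is recognizable and the relations and operations are recognizable on codes. -/
theorem Presentable.of_injective {𝓛 : FirstOrder.Language.{0, 0}} {S A : Type} [𝓛.Structure S] [Finite A]
    {enc : S → List A} (inj : Function.Injective enc)
    (hK : Rec fun w : Fin 1 → List A => ∃ x, w 0 = enc x)
    (hrel : ∀ (n : ℕ) (r : 𝓛.Relations n), ∃ F : (Fin n → List A) → Prop, Rec F ∧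
      ∀ x : Fin n → S, F (fun i => enc (x i)) ↔ Language.Structure.RelMap r x)
    (hfun : ∀ (n : ℕ) (f : 𝓛.Functions n), ∃ F : (Fin (n + 1) → List A) → Prop, Rec F ∧
      ∀ x : Fin (n + 1) → S, F (fun i => enc (x i)) ↔
        Language.Structure.funMap f (fun i : Fin n => x i.castSucc) = x (Fin.last n)) :
    Presentable 𝓛 S := by
  let K : _root_.Language A := ({w | ∃ x, w = enc x} : Set (List A))
  let φ : {w : List A // w ∈ K} → S := fun w => w.2.choose
  have hφ : ∀ w, enc (φ w) = w.1 := fun w => w.2.choose_spec.symm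
  have hpull : ∀ {n : ℕ} {R : (Fin n → S) → Prop} (F : (Fin n → List A) → Prop), Rec F →
      (∀ x : Fin n → S, F (fun i => enc (x i)) ↔ R x) → RegularRel (pullback φ R) := by
    intro n R F hF h
    have hK' : Rec fun w : Fin n → List A => ∀ i, ∃ x, w i = enc x :=
      Rec.forall_finite fun i => hK.comp fun _ => i
    refine Rec.regularRel ((hK'.and hF).congr fun w => ?_)
    constructor
    · rintro ⟨hw, hR⟩
      refine ⟨hw, ?_⟩
      rw [← h] at hR
      simpa only [hφ] using hR
    · rintro ⟨hw, hF⟩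
      refine ⟨hw, ?_⟩
      rw [← h]
      simpa only [hφ] using hF
  refine ⟨A, K, φ, inferInstance, hK.isRegular, fun x => ⟨⟨enc x, x, rfl⟩, inj (hφ _)⟩,
    hpull _ (Rec.eq 0 1) fun x => inj.eq_iff, fun n r => ?_, fun n f => ?_⟩
  · obtain ⟨F, hF, h⟩ := hrel n r
    exact hpull F hF h
  · obtain ⟨F, hF, h⟩ := hfun n f
    exact hpull F hF h

end FA

/-! ### Binary expansions and the coding of the algebra -/

namespace SquareAlgebra

open Turing FA

/-- The binary expansion of `k`, of length `i`, with the leading digit first. -/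
def bits : ℕ → ℕ → List Bool
  | 0, _ => []
  | i + 1, k => if 2 ^ i ≤ k then true :: bits i (k - 2 ^ i) else false :: bits i k

theorem length_bits (i k : ℕ) : (bits i k).length = i := by
  induction i generalizing k with
  | zero => rfl
  | succ i ih =>
    rw [bits]
    split_ifs <;> simp [ih]

/-- At fixed width with the leading digit first, the first differing digit decides, so an automaton
can read off the order of a chain. -/
theorem lex_bits {i k l : ℕ} (hk : k < 2 ^ i) (hl : l < 2 ^ i) :
    List.Lex (· < ·) (bits i k) (bits i l) ↔ k < l := by
  induction i generalizing k l with
  | zero =>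
    simp only [pow_zero, Nat.lt_one_iff] at hk hl
    simp [hk, hl, bits]
  | succ i ih =>
    rw [pow_succ] at hk hl
    rw [bits, bits]
    split_ifs with h h' h'
    · rw [List.cons_lex_cons_iff, ih (by omega) (by omega)]
      simp
      omega
    · have : ¬ k < l := by omega
      simp [List.cons_lex_cons_iff, this]
    · have : k < l := by omega
      simp [List.cons_lex_cons_iff, this]
    · rw [List.cons_lex_cons_iff, ih (by omega) (by omega)]
      simp

theorem bits_injective {i k l : ℕ} (hk : k < 2 ^ i) (hl : l < 2 ^ i) (h : bits i k = bits i l) :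
    k = l := by
  have irr : ∀ x : List Bool, ¬ List.Lex (· < ·) x x := List.lex_irrefl lt_irrefl
  have h1 := lex_bits hk hl
  have h2 := lex_bits hl hk
  rw [h] at h1 h2
  have h3 := mt h1.2 (irr _)
  have h4 := mt h2.2 (irr _)
  omega

theorem exists_eq_bits (x : List Bool) : ∃ k < 2 ^ x.length, x = bits x.length k := by
  induction x with
  | nil => exact ⟨0, by simp, rfl⟩
  | cons b x ih =>
    obtain ⟨k, hk, h⟩ := ih
    cases b
    · refine ⟨k, by rw [List.length_cons, pow_succ]; omega, ?_⟩
      rw [List.length_cons, bits, if_neg (by omega), ← h]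
    · refine ⟨2 ^ x.length + k, by rw [List.length_cons, pow_succ]; omega, ?_⟩
      rw [List.length_cons, bits, if_pos (by omega), Nat.add_sub_cancel_left, ← h]

theorem bits_max (i : ℕ) : bits i (2 ^ i - 1) = List.replicate i true := by
  induction i with
  | zero => rfl
  | succ i ih =>
    have := Nat.two_pow_pos i
    rw [bits, if_pos (by rw [pow_succ]; omega), List.replicate_succ, ← ih]
    congr 2
    rw [pow_succ]
    omega

/-- The letters of the words that code the elements of the algebra: three marks, the binary
digits, and the letters of the descriptions of configurations. -/
abbrev Letter (B Q : Type) : Type := Fin 3 ⊕ Bool ⊕ (B ⊕ Q)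

variable {B Q : Type} [Inhabited B] {T : Machine B Q} {ord : LinearOrder (B ⊕ Q)}

namespace X

/-- A coding of the elements of the algebra by words. -/
noncomputable def code : X T ord → List (Letter B Q)
  | zero => []
  | chain i k => Sum.inl 0 :: (bits i k).map (Sum.inr ∘ Sum.inl)
  | top c => Sum.inl 1 :: c.word.map (Sum.inr ∘ Sum.inr)
  | bot c => Sum.inl 2 :: c.word.map (Sum.inr ∘ Sum.inr)

omit [Inhabited B] in
theorem digit_injective :
    Function.Injective (Sum.inr ∘ Sum.inl : Bool → Letter B Q) :=
  Sum.inr_injective.comp Sum.inl_injective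

omit [Inhabited B] in
theorem symbol_injective :
    Function.Injective (Sum.inr ∘ Sum.inr : B ⊕ Q → Letter B Q) :=
  Sum.inr_injective.comp Sum.inr_injective

theorem code_injective : Function.Injective (code : X T ord → List (Letter B Q)) := by
  rintro (_ | ⟨i, k⟩ | c | c) (_ | ⟨j, l⟩ | d | d) h <;> simp [code] at h
  · rfl
  · rw [List.map_inj_right digit_injective] at h
    have hij : i = j := by simpa [length_bits] using congrArg List.length h
    subst hij
    rw [Fin.ext (bits_injective k.2 l.2 h)]
  · rw [List.map_inj_right symbol_injective] at h
    rw [Config.word_injective h]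
  · rw [List.map_inj_right symbol_injective] at h
    rw [Config.word_injective h]

/-- The strict order of the chains, on codes. -/
def CodeLT (u v : List (Letter B Q)) : Prop :=
  ∃ x y : List Bool, u = Sum.inl 0 :: x.map (Sum.inr ∘ Sum.inl) ∧
    v = Sum.inl 0 :: y.map (Sum.inr ∘ Sum.inl) ∧ x.length = y.length ∧ List.Lex (· < ·) x y

theorem codeLT_iff {u v : List (Letter B Q)} :
    CodeLT u v ↔ ∃ (i : ℕ) (k l : Fin (2 ^ i)), u = code (chain i k : X T ord) ∧
      v = code (chain i l : X T ord) ∧ k < l := by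
  constructor
  · rintro ⟨x, y, rfl, rfl, h, hlex⟩
    obtain ⟨k, hk, hx⟩ := exists_eq_bits x
    obtain ⟨l, hl, hy⟩ := exists_eq_bits y
    rw [← h] at hl hy
    refine ⟨x.length, ⟨k, hk⟩, ⟨l, hl⟩, ?_, ?_, ?_⟩
    · rw [code, ← hx]
    · rw [code, ← hy]
    · exact (lex_bits hk hl).1 (hx ▸ hy ▸ hlex)
  · rintro ⟨i, k, l, rfl, rfl, h⟩
    exact ⟨_, _, rfl, rfl, by simp [length_bits], (lex_bits k.2 l.2).2 h⟩

variable [Finite B] [Finite Q] {ι : Type} [Finite ι]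

omit [Inhabited B] in
theorem rec_codeLT (i j : ι) : Rec fun w : ι → List (Letter B Q) => CodeLT (w i) (w j) :=
  Rec.map_cons (Rec.lex_of_length_eq _ _) _ _ _ i j

omit [Inhabited B] in
theorem rec_head (a : Letter B Q) (i : ι) :
    Rec fun w : ι → List (Letter B Q) => ∃ u, w i = a :: u :=
  Rec.ex (Rec.eq_cons _ _ _)

theorem rec_code (i : ι) :
    Rec fun w : ι → List (Letter B Q) => ∃ x : X T ord, w i = code x := by
  have h0 : Rec fun w : ι → List (Letter B Q) =>
      ∃ x : List Bool, w i = Sum.inl 0 :: x.map (Sum.inr ∘ Sum.inl) ∧ x = x :=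
    Rec.map_cons₁ (Rec.eq _ _) _ _ i
  have h1 : ∀ t, Rec fun w : ι → List (Letter B Q) => ∃ x : List (B ⊕ Q),
      w i = Sum.inl t :: x.map (Sum.inr ∘ Sum.inr) ∧ ∃ c : Config B Q, x = c.word :=
    fun t => Rec.map_cons₁ (rec_word _) _ _ i
  refine ((Rec.eq_nil i).or (h0.or ((h1 1).or (h1 2)))).congr fun w => ?_
  constructor
  · rintro ⟨_ | ⟨i, k⟩ | c | c, h⟩
    · exact Or.inl h
    · exact Or.inr (Or.inl ⟨_, h, rfl⟩)
    · exact Or.inr (Or.inr (Or.inl ⟨_, h, c, rfl⟩))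
    · exact Or.inr (Or.inr (Or.inr ⟨_, h, c, rfl⟩))
  · rintro (h | ⟨x, h, -⟩ | ⟨_, h, c, rfl⟩ | ⟨_, h, c, rfl⟩)
    · exact ⟨zero, h⟩
    · obtain ⟨k, hk, hx⟩ := exists_eq_bits x
      exact ⟨chain x.length ⟨k, hk⟩, by rw [h, code, ← hx]⟩
    · exact ⟨top c, h⟩
    · exact ⟨bot c, h⟩

end X

end SquareAlgebra

/-! ### The operations on codes -/

namespace SquareAlgebra

open Turing FA

variable {B Q : Type} [Inhabited B] {T : Machine B Q} {ord : LinearOrder (B ⊕ Q)}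

namespace X

theorem code_eq_nil (x : X T ord) : code x = [] ↔ x = zero := by
  cases x <;> simp [code]

theorem code_eq_cons (x : X T ord) (t : Fin 3) : (∃ u, code x = Sum.inl t :: u) ↔
    (t = 0 ∧ ∃ i k, x = chain i k) ∨ (t = 1 ∧ ∃ c, x = top c) ∨ t = 2 ∧ ∃ c, x = bot c := by
  cases x <;> simp [code, @eq_comm _ _ t]

theorem codeLT_code_chain (u : List (Letter B Q)) (i : ℕ) (k : Fin (2 ^ i)) :
    CodeLT u (code (chain i k : X T ord)) ↔ ∃ l < k, u = code (chain i l : X T ord) := by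
  rw [codeLT_iff (T := T) (ord := ord)]
  constructor
  · rintro ⟨j, l, l', hu, h, hlt⟩
    obtain ⟨rfl, h⟩ := chain.inj (code_injective h)
    obtain rfl := eq_of_heq h
    exact ⟨l, hlt, hu⟩
  · rintro ⟨l, hlt, hu⟩
    exact ⟨i, l, k, hu, rfl, hlt⟩

theorem codeLT_code_chain_chain (i : ℕ) (k l : Fin (2 ^ i)) :
    CodeLT (code (chain i k : X T ord)) (code (chain i l : X T ord)) ↔ k < l := by
  simp [codeLT_code_chain, code_injective.eq_iff]

theorem length_code_chain (i : ℕ) (k : Fin (2 ^ i)) :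
    (code (chain i k : X T ord)).length = i + 1 := by
  simp [code, length_bits]

variable [Finite B] [Finite Q]

variable (T ord)

/-- Two chain elements lie in the same chain exactly if their codes have the same length, and then
the meet is found by comparing the codes; all other cases are visible from the marks. -/
theorem exists_rec_mul : ∃ F : (Fin 3 → List (Letter B Q)) → Prop, Rec F ∧
    ∀ x : Fin 3 → X T ord, F (fun i => code (x i)) ↔ mul (x 0) (x 1) = x 2 := by
  let G (w : Fin 3 → List (Letter B Q)) (i : Fin 3) : Prop :=
    (∃ u, w i = Sum.inl 1 :: u) ∨ ∃ u, w i = Sum.inl 2 :: u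
  have hG : ∀ i, Rec fun w => G w i := fun i => (rec_head _ i).or (rec_head _ i)
  refine ⟨fun w => (G w 0 ∧ w 2 = w 0) ∨ (¬ G w 0 ∧ G w 1 ∧ w 2 = w 1) ∨
    (¬ G w 0 ∧ ¬ G w 1 ∧ (w 0 = [] ∨ w 1 = [] ∨ (w 0).length ≠ (w 1).length) ∧ w 2 = []) ∨
    ((∃ u, w 0 = Sum.inl 0 :: u) ∧ (∃ u, w 1 = Sum.inl 0 :: u) ∧ (w 0).length = (w 1).length ∧
      (CodeLT (w 0) (w 1) ∧ w 2 = w 0 ∨ ¬ CodeLT (w 0) (w 1) ∧ w 2 = w 1)), ?_, ?_⟩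
  · exact ((hG 0).and (Rec.eq _ _)).or (((hG 0).not.and ((hG 1).and (Rec.eq _ _))).or
      (((hG 0).not.and ((hG 1).not.and (((Rec.eq_nil _).or ((Rec.eq_nil _).or
        (Rec.length_eq _ _).not)).and (Rec.eq_nil _)))).or
      ((rec_head _ _).and ((rec_head _ _).and ((Rec.length_eq _ _).and
        (((rec_codeLT _ _).and (Rec.eq _ _)).or ((rec_codeLT _ _).not.and (Rec.eq _ _))))))))
  · intro x
    simp only [G, code_eq_cons, code_injective.eq_iff, code_eq_nil]
    generalize x 0 = x, x 1 = y, x 2 = z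
    rcases x with _ | ⟨i, k⟩ | c | c <;> rcases y with _ | ⟨j, l⟩ | d | d <;>
      simp [mul, eq_comm (b := z)]
    simp only [length_code_chain, add_left_inj]
    by_cases h : i = j
    · subst h
      rw [codeLT_code_chain_chain]
      by_cases hkl : k < l
      · simp [hkl, hkl.le]
      · simp [hkl, not_lt.1 hkl]
    · simp [h]

theorem exists_rec_alpha : ∃ F : (Fin 2 → List (Letter B Q)) → Prop, Rec F ∧
    ∀ x : Fin 2 → X T ord, F (fun i => code (x i)) ↔ alpha (x 0) = x 1 := by
  refine ⟨fun w => (∃ u, w 0 = Sum.inl 1 :: u ∧ w 1 = Sum.inl 2 :: u) ∨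
    (¬ ∃ u, w 0 = Sum.inl 1 :: u) ∧ w 1 = w 0, ?_, ?_⟩
  · exact (Rec.ex ((Rec.eq_cons _ _ _).and (Rec.eq_cons _ _ _))).or
      ((rec_head _ _).not.and (Rec.eq _ _))
  · intro x
    dsimp only
    rw [code_eq_cons, code_injective.eq_iff]
    generalize x 0 = x, x 1 = y
    rcases x with _ | ⟨i, k⟩ | c | c
    · simp [alpha, @eq_comm _ y, code]
    · simp [alpha, @eq_comm _ y, code]
    · constructor
      · rintro (⟨_, hu, hv⟩ | ⟨h, -⟩)
        · refine (code_injective (hv.trans ?_)).symm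
          exact (congrArg (List.cons (Sum.inl 2)) (List.cons.inj hu).2).symm
        · exact absurd (Or.inr (Or.inl ⟨rfl, c, rfl⟩)) h
      · rintro rfl
        exact Or.inl ⟨_, rfl, rfl⟩
    · simp [alpha, @eq_comm _ y, code]

/-- The element immediately below is definable from the order: nothing lies strictly between, and
the minimum is the element with nothing below it in its chain. -/
theorem exists_rec_beta : ∃ F : (Fin 2 → List (Letter B Q)) → Prop, Rec F ∧
    ∀ x : Fin 2 → X T ord, F (fun i => code (x i)) ↔ beta (x 0) = x 1 := by
  refine ⟨fun w => ((¬ ∃ u, w 0 = Sum.inl 0 :: u) ∧ w 1 = w 0) ∨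
    ((∃ u, w 0 = Sum.inl 0 :: u) ∧ ((¬ ∃ v, CodeLT v (w 0)) ∧ w 1 = [] ∨
      CodeLT (w 1) (w 0) ∧ ¬ ∃ v, CodeLT (w 1) v ∧ CodeLT v (w 0))), ?_, ?_⟩
  · exact ((rec_head _ _).not.and (Rec.eq _ _)).or ((rec_head _ _).and
      (((Rec.ex (rec_codeLT _ _)).not.and (Rec.eq_nil _)).or
        ((rec_codeLT _ _).and (Rec.ex ((rec_codeLT _ _).and (rec_codeLT _ _))).not)))
  · intro x
    dsimp only
    rw [code_eq_cons, code_injective.eq_iff, code_eq_nil]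
    generalize x 0 = x, x 1 = y
    rcases x with _ | ⟨i, k⟩ | c | c
    · simp [beta, eq_comm]
    · have h0 : (∃ v, CodeLT v (code (chain i k : X T ord))) ↔ k.1 ≠ 0 := by
        simp only [codeLT_code_chain]
        constructor
        · rintro ⟨_, l, hl, -⟩
          exact Nat.ne_zero_of_lt hl
        · intro h
          exact ⟨_, ⟨0, Nat.two_pow_pos i⟩, Nat.pos_of_ne_zero h, rfl⟩
      rw [h0]
      by_cases hk : k.1 = 0
      · have : ¬ CodeLT (code y) (code (chain i k : X T ord)) := fun h => h0.1 ⟨_, h⟩ hk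
        simp [beta, hk, this, eq_comm (b := y)]
      · have hk' : k.1 - 1 < 2 ^ i := lt_of_le_of_lt (Nat.sub_le _ _) k.2
        simp only [beta, hk, codeLT_code_chain, code_injective.eq_iff, if_false]
        constructor
        · rintro (⟨h, -⟩ | ⟨-, ⟨h, -⟩ | ⟨⟨l, hl, rfl⟩, h⟩⟩)
          · exact absurd ⟨trivial, i, k, rfl⟩ (not_or.1 h).1
          · exact absurd hk h
          · congr
            by_contra hne
            have hlt : l.1 < k.1 - 1 := by
              have := hne
              have : l.1 < k.1 := hl
              omega
            refine h ⟨_, ?_, ⟨k.1 - 1, hk'⟩, ?_, rfl⟩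
            · exact (codeLT_code_chain_chain _ _ _).2 hlt
            · exact Nat.sub_one_lt hk
        · rintro rfl
          refine Or.inr ⟨Or.inl ⟨trivial, i, k, rfl⟩, Or.inr ⟨⟨_, Nat.sub_one_lt hk, rfl⟩, ?_⟩⟩
          rintro ⟨_, h, l, hl, rfl⟩
          have h := (codeLT_code_chain_chain _ _ _).1 h
          have h1 : k.1 - 1 < l.1 := h
          have h2 : l.1 < k.1 := hl
          omega
    · simp [beta, eq_comm]
    · simp [beta, eq_comm]

-- The maximum of $M_k$ has the code consisting of a mark and $k$ digits `true`, of length $k+1$.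
-- The code of a configuration with contents $a^k$ has length $k+2$, because of the mark and the
-- state letter. Hence the index is checked by lengthening the former by one letter and comparing
-- lengths.
open Classical in
theorem exists_rec_gamma : ∃ F : (Fin 2 → List (Letter B Q)) → Prop, Rec F ∧
    ∀ x : Fin 2 → X T ord, F (fun i => code (x i)) ↔ gamma (x 0) = x 1 := by
  let O (u : List (B ⊕ Q)) : Prop :=
    ∃ m n, u = idWord (List.replicate m T.a) T.sq (List.replicate n T.a)
  refine ⟨fun w => ((¬ ∃ u : List (B ⊕ Q), w 0 = Sum.inl 2 :: u.map (Sum.inr ∘ Sum.inr) ∧ O u) ∧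
      w 1 = w 0) ∨ (∃ u : List (B ⊕ Q), w 0 = Sum.inl 2 :: u.map (Sum.inr ∘ Sum.inr) ∧ O u) ∧
    (∃ t, t = [Sum.inl 0] ∧ ∃ k, w 1 = t ++ List.replicate k (Sum.inr (Sum.inl true))) ∧
    ∃ v, v = Sum.inl 0 :: w 1 ∧ v.length = (w 0).length, ?_, ?_⟩
  · have hO : Rec fun w : Fin 2 → List (Letter B Q) => ∃ u : List (B ⊕ Q),
        w 0 = Sum.inl 2 :: u.map (Sum.inr ∘ Sum.inr) ∧ O u :=
      Rec.map_cons₁ (rec_outputs T _) _ _ 0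
    exact (hO.not.and (Rec.eq _ _)).or (hO.and ((Rec.ex ((Rec.eq_const _ _).and
      (Rec.exists_eq_append_replicate _ _ _))).and (Rec.ex ((Rec.eq_cons _ _ _).and
        (Rec.length_eq _ _)))))
  · intro x
    dsimp only
    rw [code_injective.eq_iff]
    generalize x 0 = x, x 1 = y
    by_cases h : ∃ u : List (B ⊕ Q), code x = Sum.inl 2 :: u.map (Sum.inr ∘ Sum.inr) ∧ O u
    · simp only [h, not_true_eq_false, false_and, true_and, false_or]
      obtain ⟨u, hx, m, n, hu⟩ := h
      obtain ⟨c, rfl⟩ : ∃ c, x = bot c := by cases x <;> simp [code] at hx ⊢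
      simp only [code, List.cons.injEq, true_and, List.map_inj_right symbol_injective] at hx
      have hc : T.Outputs c (m + n) := (outputs_iff T c _).2 ⟨m, n, rfl, hx.trans hu⟩
      have hlen : c.contents.length = m + n := by rw [hc.2, List.length_replicate]
      have hlen' : (code (bot c : X T ord)).length = m + n + 2 := by
        simp [code, hx, hu, idWord]
        omega
      rw [gamma, hlen, if_pos hc, hlen']
      have hmax : code (chainMax (m + n) : X T ord) =
          Sum.inl 0 :: List.replicate (m + n) (Sum.inr (Sum.inl true)) := by
        simp [code, chainMax, bits_max]
      rw [← code_injective.eq_iff, hmax]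
      constructor
      · rintro ⟨⟨_, rfl, k, hk⟩, _, rfl, h⟩
        rw [hk] at h ⊢
        simp at h
        simp [h]
      · intro h
        rw [← h]
        exact ⟨⟨_, rfl, m + n, rfl⟩, _, rfl, by simp⟩
    · simp only [h, not_false_eq_true, false_and, true_and, or_false]
      have : gamma x = x := by
        cases x with
        | bot c =>
          rw [gamma, if_neg]
          intro hc
          obtain ⟨m, n, -, hmn⟩ := (outputs_iff T c _).1 hc
          exact h ⟨c.word, rfl, m, n, hmn⟩
        | _ => rfl
      rw [this, eq_comm]

theorem exists_rec_delta : ∃ F : (Fin 2 → List (Letter B Q)) → Prop, Rec F ∧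
    ∀ x : Fin 2 → X T ord, F (fun i => code (x i)) ↔ delta (x 0) = x 1 := by
  refine ⟨fun w => (∃ u v : List (B ⊕ Q), w 0 = Sum.inl 2 :: u.map (Sum.inr ∘ Sum.inr) ∧
      w 1 = Sum.inl 2 :: v.map (Sum.inr ∘ Sum.inr) ∧
      ∃ c : Config B Q, u = c.word ∧ v = (T.step c).word) ∨
    (¬ ∃ u, w 0 = Sum.inl 2 :: u) ∧ w 1 = w 0, ?_, ?_⟩
  · exact (Rec.map_cons (rec_step T _ _) _ _ _ _ _).or ((rec_head _ _).not.and (Rec.eq _ _))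
  · intro x
    dsimp only
    rw [code_eq_cons, code_injective.eq_iff]
    generalize x 0 = x, x 1 = y
    rcases x with _ | ⟨i, k⟩ | c | c
    · simp [delta, @eq_comm _ y, code]
    · simp [delta, @eq_comm _ y, code]
    · simp [delta, @eq_comm _ y, code]
    · constructor
      · rintro (⟨_, _, hu, hv, d, rfl, rfl⟩ | ⟨h, -⟩)
        · obtain rfl : c = d := bot.inj (code_injective (T := T) (ord := ord) hu)
          exact (code_injective hv).symm
        · exact absurd (Or.inr (Or.inr ⟨rfl, c, rfl⟩)) h
      · rintro rfl
        exact Or.inl ⟨_, _, rfl, rfl, c, rfl, rfl⟩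

theorem exists_rec_zeta (ha : T.a ≠ default) :
    ∃ F : (Fin 2 → List (Letter B Q)) → Prop, Rec F ∧
    ∀ x : Fin 2 → X T ord, F (fun i => code (x i)) ↔ zeta (x 0) = x 1 := by
  refine ⟨fun w => (∃ u v : List (B ⊕ Q), w 0 = Sum.inl 1 :: u.map (Sum.inr ∘ Sum.inr) ∧
      w 1 = Sum.inl 1 :: v.map (Sum.inr ∘ Sum.inr) ∧
      ∃ c : Config B Q, u = c.word ∧ v = (next ord c).word) ∨
    (¬ ∃ u, w 0 = Sum.inl 1 :: u) ∧ w 1 = w 0, ?_, ?_⟩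
  · exact (Rec.map_cons (rec_next ord ha _ _) _ _ _ _ _).or
      ((rec_head _ _).not.and (Rec.eq _ _))
  · intro x
    dsimp only
    rw [code_eq_cons, code_injective.eq_iff]
    generalize x 0 = x, x 1 = y
    rcases x with _ | ⟨i, k⟩ | c | c
    · simp [zeta, @eq_comm _ y, code]
    · simp [zeta, @eq_comm _ y, code]
    · constructor
      · rintro (⟨_, _, hu, hv, d, rfl, rfl⟩ | ⟨h, -⟩)
        · obtain rfl : c = d := top.inj (code_injective (T := T) (ord := ord) hu)
          exact (code_injective hv).symm
        · exact absurd (Or.inr (Or.inl ⟨rfl, c, rfl⟩)) h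
      · rintro rfl
        exact Or.inl ⟨_, _, rfl, rfl, c, rfl, rfl⟩
    · simp [zeta, @eq_comm _ y, code]

theorem presentable : FA.Presentable sig (X T ord) := by
  refine Presentable.of_injective code_injective (rec_code 0) (fun n r => r.elim) fun n f => ?_
  match n, f with
  | _, .mul => exact exists_rec_mul T ord
  | _, .alpha => exact exists_rec_alpha T ord
  | _, .beta => exact exists_rec_beta T ord
  | _, .gamma => exact exists_rec_gamma T ord
  | _, .delta => exact exists_rec_delta T ord
  | _, .zeta => exact exists_rec_zeta T ord T.a_ne_blank

end X

end SquareAlgebra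

/-! ### Generation of the algebra and of its subalgebra -/

namespace SquareAlgebra

open Turing FirstOrder

variable {B Q : Type} [Inhabited B] {T : Machine B Q} {ord : LinearOrder (B ⊕ Q)}

namespace X

section Mem

variable {N : sig.Substructure (X T ord)} {x : X T ord}

theorem alpha_mem (h : x ∈ N) : alpha x ∈ N :=
  N.fun_mem (n := 1) Op.alpha (fun _ => x) fun _ => h

theorem beta_mem (h : x ∈ N) : beta x ∈ N :=
  N.fun_mem (n := 1) Op.beta (fun _ => x) fun _ => h

theorem gamma_mem (h : x ∈ N) : gamma x ∈ N :=
  N.fun_mem (n := 1) Op.gamma (fun _ => x) fun _ => h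

theorem delta_mem (h : x ∈ N) : delta x ∈ N :=
  N.fun_mem (n := 1) Op.delta (fun _ => x) fun _ => h

theorem zeta_mem (h : x ∈ N) : zeta x ∈ N :=
  N.fun_mem (n := 1) Op.zeta (fun _ => x) fun _ => h

theorem chain_mem {i : ℕ} (h : chainMax i ∈ N) (k : Fin (2 ^ i)) : chain i k ∈ N := by
  obtain ⟨n, hn⟩ : ∃ n, k.1 + n = 2 ^ i - 1 := ⟨2 ^ i - 1 - k.1, by have := k.2; omega⟩
  induction n generalizing k with
  | zero => rwa [chainMax, show (⟨2 ^ i - 1, _⟩ : Fin (2 ^ i)) = k from Fin.ext hn.symm] at h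
  | succ n ih =>
    have := beta_mem (ih ⟨k.1 + 1, by have := Nat.two_pow_pos i; omega⟩ (by dsimp only; omega))
    simpa [beta] using this

theorem zero_mem {i : ℕ} (h : chainMax i ∈ N) : zero ∈ N := by
  have := beta_mem (chain_mem h ⟨0, Nat.two_pow_pos i⟩)
  simpa [beta] using this

theorem gamma_bot {c : Config B Q} {k : ℕ} (h : T.Outputs c k) :
    gamma (bot c : X T ord) = chainMax k := by
  have hk : c.contents.length = k := by rw [h.2, List.length_replicate]
  rw [gamma, hk, if_pos h]

end Mem

theorem exists_outputs (T : Machine B Q) (k : ℕ) : ∃ c, T.Outputs c k := by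
  refine ⟨Config.ofLists [] T.sq (List.replicate k T.a), rfl, ?_⟩
  rw [Config.contents, Config.left_ofLists (by simp), Config.right_ofLists]
  · rfl
  · rw [List.getLast?_replicate]
    split_ifs
    · simp
    · simpa using T.a_ne_blank

variable [Finite B] [Finite Q]

theorem finite_precedes (c : Config B Q) : {d | Precedes ord d c}.Finite := by
  refine Set.Finite.subset ((List.finite_length_le (B ⊕ Q) c.word.length).preimage
    Config.word_injective.injOn) fun d hd => ?_
  exact Precedes.length_le hd

/-- Every configuration is a finite number of successor steps away from the first one. -/
theorem exists_iterate_next (ord : LinearOrder (B ⊕ Q)) {a : B} (ha : a ≠ default)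
    (c₁ : Config B Q) : ∃ c₀ : Config B Q, ∀ c, ∃ n, (next ord)^[n] c₀ = c := by
  have hne : (Set.univ : Set (Config B Q)).Nonempty := ⟨c₁, trivial⟩
  refine ⟨(Precedes.wellFounded ord).min _ hne, fun c => ?_⟩
  by_contra! hc
  have hnext := isNext_next ord ha
  set c₀ := (Precedes.wellFounded ord).min _ hne
  -- If the orbit of the least configuration missed `c`, it would stay below `c` for ever; being
  -- strictly increasing, it would be an infinite subset of a finite set.
  have below : ∀ n, Precedes ord ((next ord)^[n] c₀) c := by
    intro n
    induction n with
    | zero =>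
      rcases Precedes.trichotomy ord c₀ c with h | h | h
      · exact h
      · exact absurd h (hc 0)
      · exact absurd h ((Precedes.wellFounded ord).not_lt_min _ (Set.mem_univ c))
    | succ n ih =>
      rw [Function.iterate_succ_apply']
      refine ((hnext _).2 c ih).resolve_left fun h => hc (n + 1) ?_
      rw [Function.iterate_succ_apply', h]
  have mono : ∀ m k, Precedes ord ((next ord)^[m] c₀) ((next ord)^[m + k + 1] c₀) := by
    intro m k
    induction k with
    | zero =>
      rw [add_zero, Function.iterate_succ_apply']
      exact (hnext _).1
    | succ k ih =>
      refine ih.trans ?_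
      rw [← add_assoc, Function.iterate_succ_apply' _ (m + k + 1)]
      exact (hnext _).1
  have inj : Function.Injective fun n => (next ord)^[n] c₀ := by
    have : ∀ m n, m < n → (next ord)^[m] c₀ ≠ (next ord)^[n] c₀ := by
      intro m n hmn e
      obtain ⟨k, rfl⟩ := Nat.exists_eq_add_of_lt hmn
      have h := mono m k
      rw [← e] at h
      exact Precedes.irrefl _ h
    intro m n e
    rcases lt_trichotomy m n with h | h | h
    · exact absurd e (this _ _ h)
    · exact h
    · exact absurd e.symm (this _ _ h)
  exact Set.infinite_of_injective_forall_mem inj below (finite_precedes c)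

variable (T ord)

/-- Since the successor map runs through all configurations, reachable or not, every tape $a^k$ in
state `sq` occurs and every chain maximum is generated. -/
theorem fg : Language.Structure.FG sig (X T ord) := by
  obtain ⟨c₀, hc₀⟩ := exists_iterate_next ord T.a_ne_blank T.init
  refine ⟨⟨{top c₀}, ?_⟩⟩
  rw [eq_top_iff]
  intro x _
  set N := Language.Substructure.closure sig (({top c₀} : Finset (X T ord)) : Set (X T ord))
  have htop : ∀ c, top c ∈ N := by
    intro c
    obtain ⟨n, rfl⟩ := hc₀ c
    induction n with
    | zero => exact Language.Substructure.subset_closure (by simp)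
    | succ n ih =>
      rw [Function.iterate_succ_apply']
      exact zeta_mem ih
  have hbot : ∀ c, bot c ∈ N := fun c => alpha_mem (htop c)
  have hmax : ∀ i, chainMax i ∈ N := by
    intro i
    obtain ⟨c, hc⟩ := exists_outputs T i
    rw [← gamma_bot hc]
    exact gamma_mem (hbot c)
  rcases x with _ | ⟨i, k⟩ | c | c
  · exact zero_mem (hmax 0)
  · exact chain_mem (hmax i) k
  · exact htop c
  · exact hbot c

end X

variable (ord)

omit ord in
theorem Machine.Outputs.unique {c : Config B Q} {k l : ℕ} (h : T.Outputs c k)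
    (h' : T.Outputs c l) : k = l := by
  rw [← List.length_replicate (n := k) (a := T.a), ← h.2, h'.2, List.length_replicate]

/-- No element of the copy `top` can arise, so `alpha` and `zeta` act trivially, and `gamma` sees
only configurations of the actual computation. There the second clause of `GeneratesSquares`
confines its values to chains of square index, and the first clause supplies all of them. -/
theorem coe_Y (hT : T.GeneratesSquares) : (Y T ord : Set (X T ord)) =
    {X.zero} ∪ {x | ∃ n : ℕ, x = X.bot (T.step^[n] T.init)} ∪
      {x | ∃ (j : ℕ) (k : Fin (2 ^ j ^ 2)), 1 ≤ j ∧ x = X.chain (j ^ 2) k} := by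
  obtain ⟨⟨t, -, ht⟩, hsq⟩ := hT
  apply Set.Subset.antisymm
  · have closed : ∀ {n : ℕ} (f : sig.Functions n), Language.ClosedUnder f
        ({X.zero} ∪ {x | ∃ n : ℕ, x = X.bot (T.step^[n] T.init)} ∪ {x | ∃ (j : ℕ)
          (k : Fin (2 ^ j ^ 2)), 1 ≤ j ∧ x = X.chain (j ^ 2) k} : Set (X T ord)) := by
      intro n f x h
      match n, f with
      | _, .mul =>
        change X.mul (x 0) (x 1) ∈ _
        have h0 := h 0
        have h1 := h 1
        generalize x 0 = x, x 1 = y at *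
        rcases h0 with (rfl | ⟨m, rfl⟩) | ⟨i, k, hi, rfl⟩
        · rcases h1 with (rfl | ⟨m, rfl⟩) | ⟨j, l, hj, rfl⟩
          · exact Or.inl (Or.inl rfl)
          · exact Or.inl (Or.inr ⟨m, rfl⟩)
          · exact Or.inl (Or.inl rfl)
        · exact Or.inl (Or.inr ⟨m, by rfl⟩)
        · rcases h1 with (rfl | ⟨m, rfl⟩) | ⟨j, l, hj, rfl⟩
          · exact Or.inl (Or.inl rfl)
          · exact Or.inl (Or.inr ⟨m, rfl⟩)
          · rw [X.mul]
            split_ifs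
            · exact Or.inr ⟨i, _, hi, rfl⟩
            · exact Or.inl (Or.inl rfl)
      | _, .alpha =>
        change X.alpha (x 0) ∈ _
        rcases h 0 with (h | ⟨m, h⟩) | ⟨i, k, hi, h⟩
        · rw [h]; exact Or.inl (Or.inl rfl)
        · rw [h]; exact Or.inl (Or.inr ⟨m, rfl⟩)
        · rw [h]; exact Or.inr ⟨i, k, hi, rfl⟩
      | _, .beta =>
        change X.beta (x 0) ∈ _
        rcases h 0 with (h | ⟨m, h⟩) | ⟨i, k, hi, h⟩
        · rw [h]; exact Or.inl (Or.inl rfl)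
        · rw [h]; exact Or.inl (Or.inr ⟨m, rfl⟩)
        · rw [h, X.beta]
          split_ifs
          · exact Or.inl (Or.inl rfl)
          · exact Or.inr ⟨i, _, hi, rfl⟩
      | _, .gamma =>
        change X.gamma (x 0) ∈ _
        rcases h 0 with (h | ⟨m, h⟩) | ⟨i, k, hi, h⟩
        · rw [h]; exact Or.inl (Or.inl rfl)
        · rw [h, X.gamma]
          split_ifs with ho
          · obtain ⟨j, hj, hoj⟩ := hsq m ho.1
            rw [ho.unique hoj]
            exact Or.inr ⟨j, _, hj, rfl⟩
          · exact Or.inl (Or.inr ⟨m, rfl⟩)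
        · rw [h]; exact Or.inr ⟨i, k, hi, rfl⟩
      | _, .delta =>
        change X.delta (x 0) ∈ _
        rcases h 0 with (h | ⟨m, h⟩) | ⟨i, k, hi, h⟩
        · rw [h]; exact Or.inl (Or.inl rfl)
        · rw [h]; exact Or.inl (Or.inr ⟨m + 1, by rw [Function.iterate_succ_apply']; rfl⟩)
        · rw [h]; exact Or.inr ⟨i, k, hi, rfl⟩
      | _, .zeta =>
        change X.zeta (x 0) ∈ _
        rcases h 0 with (h | ⟨m, h⟩) | ⟨i, k, hi, h⟩
        · rw [h]; exact Or.inl (Or.inl rfl)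
        · rw [h]; exact Or.inl (Or.inr ⟨m, rfl⟩)
        · rw [h]; exact Or.inr ⟨i, k, hi, rfl⟩
    refine fun x hx => (Language.Substructure.closure_le (S := ⟨_, closed⟩)).2 ?_ hx
    rintro x rfl
    exact Or.inl (Or.inr ⟨0, rfl⟩)
  · have hbot : ∀ n, X.bot (T.step^[n] T.init) ∈ Y T ord := by
      intro n
      induction n with
      | zero => exact Language.Substructure.subset_closure rfl
      | succ n ih =>
        rw [Function.iterate_succ_apply']
        exact X.delta_mem ih
    have hmax : ∀ j, 1 ≤ j → X.chainMax (j ^ 2) ∈ Y T ord := by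
      intro j hj
      rw [← X.gamma_bot (ht j hj)]
      exact X.gamma_mem (hbot _)
    rintro x ((rfl | ⟨n, rfl⟩) | ⟨j, k, hj, rfl⟩)
    · exact X.zero_mem (hmax 1 le_rfl)
    · exact hbot n
    · exact X.chain_mem (hmax j hj) k

theorem chain_mem_Y_iff (hT : T.GeneratesSquares) (i : ℕ) (k : Fin (2 ^ i)) :
    X.chain i k ∈ Y T ord ↔ ∃ j : ℕ, 1 ≤ j ∧ i = j ^ 2 := by
  rw [← SetLike.mem_coe, coe_Y ord hT]
  constructor
  · rintro ((h | ⟨n, h⟩) | ⟨j, l, hj, h⟩)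
    · cases h
    · cases h
    · exact ⟨j, hj, (X.chain.inj h).1⟩
  · rintro ⟨j, hj, rfl⟩
    exact Or.inr ⟨j, k, hj, rfl⟩

end SquareAlgebra

/-! ### Pumping and counting -/

namespace FA

section Pumping

variable {A : Type}

/-- Pumping with all exponents gives words in the language whose lengths run through an arithmetic
progression. -/
theorem exists_pumping {L : Language A} (h : L.IsRegular) :
    ∃ p, ∀ x ∈ L, p ≤ x.length → ∃ (f : ℕ → List A) (m n : ℕ), 0 < n ∧
      ∀ k, f k ∈ L ∧ (f k).length = m + n * k := by
  obtain ⟨σ, _, M, rfl⟩ := h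
  refine ⟨Fintype.card σ, fun x hx hlen => ?_⟩
  obtain ⟨a, b, c, -, -, hb, hle⟩ := M.pumping_lemma hx hlen
  refine ⟨fun k => a ++ (List.replicate k b).flatten ++ c, a.length + c.length, b.length,
    List.length_pos_iff.2 hb, fun k => ⟨hle ?_, ?_⟩⟩
  · refine Language.append_mem_mul (Language.append_mem_mul rfl ?_) rfl
    exact Language.join_mem_kstar fun y hy => (List.mem_replicate.1 hy).2
  · simp
    ring

/-- Padding to length `m` embeds the set into the words of length `m` over an alphabet with one more
letter. -/
theorem ncard_le_of_length_le [Finite A] {s : Set (List A)} {m : ℕ} (h : ∀ x ∈ s, x.length ≤ m) :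
    s.ncard ≤ (Nat.card A + 1) ^ m := by
  classical
  have hc : Nat.card (Fin m → Option A) = (Nat.card A + 1) ^ m := by
    rw [Nat.card_fun, Nat.card_fin, Finite.card_option]
  rw [← hc, ← Set.ncard_univ]
  refine Set.ncard_le_ncard_of_injOn (fun x (i : Fin m) => x[i.1]?) (fun _ _ => trivial) ?_
  intro x hx y hy e
  refine List.ext_getElem? fun k => ?_
  rcases lt_or_ge k m with hk | hk
  · exact congrFun e ⟨k, hk⟩
  · rw [List.getElem?_eq_none ((h x hx).trans hk), List.getElem?_eq_none ((h y hy).trans hk)]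

/-- If a word is related to finitely many words by a recognizable relation, then their lengths
exceed its length at most by a constant. -/
theorem Rec.exists_length_le {P : List A → List A → Prop}
    (h : Rec fun w : Bool → List A => P (w false) (w true)) :
    ∃ c, ∀ x, {y | P x y}.Finite → ∀ y, P x y → y.length ≤ x.length + c := by
  obtain ⟨_, ⟨σ, _, M, rfl⟩, h⟩ := h
  let g (a : A) (i : Bool) : Option A := cond i (some a) none
  refine ⟨Fintype.card σ, fun x hfin y hy => ?_⟩
  by_contra! hlen
  -- Beyond the end of `x` only the second track carries letters, so the convolution splits into a
  -- fixed prefix and the word `z` written beside padding.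
  have pc : ∀ z, padConv (x.length + z.length) (fun i => cond i (y.take x.length ++ z) x) =
      padConv x.length (fun i => cond i (y.take x.length) x) ++ z.map g := by
    intro z
    refine List.ext_getElem? fun k => ?_
    rcases lt_or_ge k x.length with hk | hk
    · rw [List.getElem?_append_left (by rwa [length_padConv])]
      simp only [padConv, List.getElem?_map, List.getElem?_range hk,
        List.getElem?_range (hk.trans_le (Nat.le_add_right _ _)), Option.map_some]
      congr 1
      funext i
      cases i
      · rfl
      · exact List.getElem?_append_left (by rw [List.length_take]; omega)
    · rw [List.getElem?_append_right (by rwa [length_padConv]), length_padConv]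
      obtain ⟨k, rfl⟩ := Nat.exists_eq_add_of_le hk
      rw [Nat.add_sub_cancel_left]
      rcases lt_or_ge k z.length with hz | hz
      · simp only [padConv, List.getElem?_map, List.getElem?_range (Nat.add_lt_add_left hz _),
          Option.map_some, List.getElem?_eq_getElem hz]
        congr 1
        funext i
        cases i
        · exact List.getElem?_eq_none hk
        · have : (y.take x.length).length = x.length := by rw [List.length_take]; omega
          simp only [cond_true, g]
          rw [List.getElem?_append_right (by omega), this, Nat.add_sub_cancel_left,
            List.getElem?_eq_getElem hz]
      · rw [List.getElem?_eq_none, List.getElem?_eq_none]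
        · simpa using hz
        · rw [length_padConv]
          omega
  -- Started in the state reached after this prefix, the automaton accepts exactly the admissible
  -- continuations `z`. A continuation with at least as many letters as there are states could be
  -- pumped, giving infinitely many `y`.
  let M' : DFA A σ := (⟨M.step, M.eval (padConv x.length fun i => cond i (y.take x.length) x),
    M.accept⟩ : DFA (Bool → Option A) σ).comap g
  have key : ∀ z, z ∈ M'.accepts ↔ P x (y.take x.length ++ z) := by
    intro z
    have hw : ∀ i : Bool, (cond i (y.take x.length ++ z) x).length ≤ x.length + z.length := by
      rintro (_ | _)
      · exact Nat.le_add_right _ _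
      · simp
    refine Iff.trans ?_ (h (fun i => cond i (y.take x.length ++ z) x) _ hw)
    have e : M'.eval z = M.evalFrom (M.eval (padConv x.length fun i => cond i (y.take x.length) x))
        (z.map g) := DFA.eval_comap _ _ _
    rw [pc, DFA.mem_accepts, DFA.mem_accepts, e]
    unfold DFA.eval
    rw [DFA.evalFrom_of_append]
    rfl
  have hmem : y.drop x.length ∈ M'.accepts := by
    rw [key, List.take_append_drop]
    exact hy
  obtain ⟨a, b, c, -, -, hb, hle⟩ := M'.pumping_lemma hmem (by rw [List.length_drop]; omega)
  refine Set.infinite_of_injective_forall_mem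
    (f := fun k => y.take x.length ++ (a ++ (List.replicate k b).flatten ++ c)) ?_ ?_ hfin
  · intro k l e
    have := congrArg List.length e
    have hb := List.length_pos_iff.2 hb
    simpa [hb.ne'] using this
  · intro k
    refine (key _).1 (hle ?_)
    refine Language.append_mem_mul (Language.append_mem_mul rfl ?_) rfl
    exact Language.join_mem_kstar fun y hy => (List.mem_replicate.1 hy).2

end Pumping

/-- Infinitely many elements of an infinite regular language that is parametrized injectively by
natural numbers cannot have a length that is quadratic in the parameter. -/
theorem exists_lt_sq_of_isRegular {A : Type} [Finite A] {L : Language A} (h : L.IsRegular)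
    (hinf : Set.Infinite {x | x ∈ L}) {j : List A → ℕ} (hj : Set.InjOn j {x | x ∈ L})
    (d c : ℕ) : ∃ x ∈ L, d * (x.length + c) < j x ^ 2 := by
  obtain ⟨p, hp⟩ := exists_pumping h
  obtain ⟨x, hx, hlen⟩ : ∃ x ∈ L, p ≤ x.length := by
    by_contra! hlt
    exact hinf ((List.finite_length_lt A p).subset hlt)
  obtain ⟨f, m, n, hn, hf⟩ := hp x hx hlen
  have finj : Function.Injective f := fun k l e => by
    have := congrArg List.length e
    rw [(hf k).2, (hf l).2] at this
    exact Nat.eq_of_mul_eq_mul_left hn (Nat.add_left_cancel this)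
  -- Put $K=dn+d(m+c)+2$. The $K+1$ words `f 0`, …, `f K` have distinct parameters, so one of these
  -- is at least $K$, whereas $d(m+nK+c)\le dnK+d(m+c)<K^2$.
  obtain ⟨k, hk, hjk⟩ : ∃ k < d * n + d * (m + c) + 2 + 1,
      d * n + d * (m + c) + 2 ≤ j (f k) := by
    by_contra! hlt
    obtain ⟨k, hk, l, hl, hne, e⟩ := Finset.exists_ne_map_eq_of_card_lt_of_maps_to
      (s := Finset.range (d * n + d * (m + c) + 2 + 1))
      (t := Finset.range (d * n + d * (m + c) + 2)) (f := fun k => j (f k)) (by simp)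
      (fun k hk => by simpa using hlt k (by simpa using hk))
    exact hne (finj (hj (hf k).1 (hf l).1 e))
  refine ⟨f k, (hf k).1, ?_⟩
  rw [(hf k).2]
  have h1 : (d * n + d * (m + c) + 2) ^ 2 ≤ j (f k) ^ 2 := Nat.pow_le_pow_left hjk 2
  have h2 : d * n * k ≤ d * n * (d * n + d * (m + c) + 2) :=
    Nat.mul_le_mul_left _ (Nat.lt_succ_iff.1 hk)
  have h3 : d * (m + n * k + c) = d * n * k + d * (m + c) := by ring
  rw [h3]
  generalize d * n = α at *
  generalize d * (m + c) = β at *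
  nlinarith [Nat.zero_le (α * β), Nat.zero_le (β * β)]

end FA

/-! ### The subalgebra has no automatic presentation -/

namespace SquareAlgebra

open Turing FirstOrder FA

variable {B Q : Type} [Inhabited B] {T : Machine B Q} {ord : LinearOrder (B ⊕ Q)}

namespace X

theorem mul_zero_eq_zero_iff (x : X T ord) :
    mul zero x = zero ↔ x = zero ∨ ∃ i k, x = chain i k := by
  cases x <;> simp [mul]

theorem mul_chain_chain (i : ℕ) (k l : Fin (2 ^ i)) :
    mul (chain i k : X T ord) (chain i l) = chain i (min k l) := by
  rw [mul, if_pos rfl]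
  congr

theorem le_chainMax {i : ℕ} (k : Fin (2 ^ i)) :
    k ≤ ⟨2 ^ i - 1, Nat.sub_lt (Nat.two_pow_pos i) one_pos⟩ :=
  Nat.le_sub_one_of_lt k.2

end X

-- Only equality and the multiplication of the presentation are used. The semilattice part, the
-- maxima of its chains and the elements below a maximum are first-order definable from them with
-- one constant for the zero. Canonical words turn the count of elements into a count of words.
open X in
theorem not_presentable_Y (hT : T.GeneratesSquares) : ¬ FA.Presentable sig (Y T ord) := by
  classical
  rintro ⟨A, K, φ, hP⟩
  have := hP.finite_alphabet
  let _ : LinearOrder A := LinearOrder.lift' (Finite.equivFin A) (Finite.equivFin A).injective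
  -- `Den u x`: the word `u` denotes the element `x`
  let Den (u : List A) (x : X T ord) : Prop := ∃ h : u ∈ K, (φ ⟨u, h⟩ : X T ord) = x
  have den_unique : ∀ {u x y}, Den u x → Den u y → x = y := by
    rintro u _ _ ⟨h, rfl⟩ ⟨_, rfl⟩
    rfl
  have den_mem : ∀ {u x}, Den u x → x ∈ Y T ord := by
    rintro u _ ⟨h, rfl⟩
    exact (φ ⟨u, h⟩).2
  have den_exists : ∀ {x}, x ∈ Y T ord → ∃ u, Den u x := by
    intro x hx
    obtain ⟨⟨u, hu⟩, h⟩ := hP.surjective ⟨x, hx⟩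
    exact ⟨u, hu, by rw [h]⟩
  let Eqv (u v : List A) : Prop := ∃ x, Den u x ∧ Den v x
  let Mul (u v w : List A) : Prop := ∃ x y, Den u x ∧ Den v y ∧ Den w (mul x y)
  have rec_eqv : ∀ {ι : Type} (i j : ι), Rec fun w : ι → List A => Eqv (w i) (w j) := by
    intro ι i j
    have h : Rec fun w : Fin 2 → List A => Eqv (w 0) (w 1) := by
      refine (RegularRel.rec hP.eq_regular).congr fun w => ?_
      constructor
      · rintro ⟨_, ⟨h0, rfl⟩, h1, e⟩
        exact ⟨fun i => by fin_cases i <;> assumption, Subtype.ext e.symm⟩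
      · rintro ⟨h, e⟩
        exact ⟨_, ⟨h 0, rfl⟩, h 1, congrArg Subtype.val e.symm⟩
    exact h.comp ![i, j]
  have rec_mul : ∀ {ι : Type} (i j k : ι),
      Rec fun w : ι → List A => Mul (w i) (w j) (w k) := by
    intro ι i j k
    have h : Rec fun w : Fin 3 → List A => Mul (w 0) (w 1) (w 2) := by
      refine (RegularRel.rec (hP.fun_regular 2 Op.mul)).congr fun w => ?_
      constructor
      · rintro ⟨_, _, ⟨h0, rfl⟩, ⟨h1, rfl⟩, h2, e⟩
        exact ⟨fun i => by fin_cases i <;> assumption, Subtype.ext e.symm⟩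
      · rintro ⟨h, e⟩
        exact ⟨_, _, ⟨h 0, rfl⟩, ⟨h 1, rfl⟩, h 2, congrArg Subtype.val e.symm⟩
    exact h.comp ![i, j, k]
  -- canonical words
  let Can (u : List A) : Prop := Eqv u u ∧ ¬ ∃ v, Eqv u v ∧ List.Shortlex (· < ·) v u
  have rec_can : ∀ {ι : Type} [Finite ι] (i : ι), Rec fun w : ι → List A => Can (w i) :=
    fun i => (rec_eqv _ _).and (Rec.ex ((rec_eqv _ _).and (Rec.shortlex _ _))).not
  have can_unique : ∀ {u v x}, Can u → Can v → Den u x → Den v x → u = v := by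
    intro u v x hu hv hux hvx
    rcases shortlex_trichotomy u v with h | h | h
    · exact absurd ⟨u, ⟨x, hvx, hux⟩, h⟩ hv.2
    · exact h
    · exact absurd ⟨v, ⟨x, hux, hvx⟩, h⟩ hu.2
  have can_exists : ∀ {x}, x ∈ Y T ord → ∃ u, Can u ∧ Den u x := by
    intro x hx
    have wf : WellFounded (List.Shortlex ((· < ·) : A → A → Prop)) :=
      List.Shortlex.wf wellFounded_lt
    have hne : {u | Den u x}.Nonempty := den_exists hx
    have hm : Den (wf.min _ hne) x := wf.min_mem _ hne
    refine ⟨wf.min _ hne, ⟨⟨x, hm, hm⟩, ?_⟩, hm⟩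
    rintro ⟨v, ⟨y, hy, hv⟩, h⟩
    obtain rfl := den_unique hm hy
    exact wf.not_lt_min _ hv h
  -- The subalgebra contains each chain completely or not at all.
  have hchain : ∀ {i k}, (chain i k : X T ord) ∈ Y T ord → ∀ l, (chain i l : X T ord) ∈ Y T ord :=
    fun h l => (chain_mem_Y_iff ord hT _ _).2 ((chain_mem_Y_iff ord hT _ _).1 h)
  obtain ⟨z, hz⟩ : ∃ z, Den z zero := den_exists (by
    rw [← SetLike.mem_coe, coe_Y ord hT]
    exact Or.inl (Or.inl rfl))
  -- the semilattice of the chains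
  let Sl (u : List A) : Prop := Mul z u z
  -- The constant `z` is turned into a quantified word equal to `z`, since recognizability is stated
  -- for tracks only.
  have rec_sl : ∀ {ι : Type} [Finite ι] (i : ι), Rec fun w : ι → List A => Sl (w i) :=
    fun i => (Rec.ex (P := fun w v => v = z ∧ Mul v (w i) v)
      ((Rec.eq_const z none).and (rec_mul none (some i) none))).congr fun w => by simp [Sl]
  have sl_iff : ∀ {u x}, Den u x → (Sl u ↔ x = zero ∨ ∃ i k, x = chain i k) := by
    intro u x hu
    rw [← mul_zero_eq_zero_iff]
    constructor
    · rintro ⟨a, b, ha, hb, h⟩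
      rw [den_unique ha hz, den_unique hb hu] at h
      exact den_unique h hz
    · intro h
      exact ⟨zero, x, hz, hu, by rwa [h]⟩
  -- the canonical words of the maxima of the chains
  let Top (u : List A) : Prop := Can u ∧ Sl u ∧ (¬ ∃ v, v = z ∧ Eqv u v) ∧
    ∀ v, Sl v → Mul u v u → Eqv u v
  have rec_top : ∀ {ι : Type} [Finite ι] (i : ι), Rec fun w : ι → List A => Top (w i) :=
    fun i => (rec_can _).and ((rec_sl _).and ((Rec.ex ((Rec.eq_const _ _).and (rec_eqv _ _))).not.and
      (Rec.all ((rec_sl _).imp ((rec_mul _ _ _).imp (rec_eqv _ _))))))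
  -- A maximal element of the semilattice part is compared with the maximum of its own chain, which
  -- also belongs to the subalgebra.
  have top_max : ∀ {u}, Top u → ∃ j : ℕ, Den u (chainMax (j ^ 2)) := by
    rintro u ⟨⟨⟨x, hx, -⟩, -⟩, hs, h0, hmax⟩
    rcases (sl_iff hx).1 hs with rfl | ⟨i, k, rfl⟩
    · exact absurd ⟨z, rfl, zero, hx, hz⟩ h0
    · obtain ⟨j, hj, rfl⟩ := (chain_mem_Y_iff ord hT _ _).1 (den_mem hx)
      obtain ⟨v, hv⟩ := den_exists (hchain (den_mem hx)
        ⟨2 ^ j ^ 2 - 1, Nat.sub_lt (Nat.two_pow_pos _) one_pos⟩)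
      obtain ⟨y, hy, hy'⟩ := hmax v ((sl_iff hv).2 (Or.inr ⟨_, _, rfl⟩))
        ⟨_, _, hx, hv, by rwa [mul_chain_chain, min_eq_left (le_chainMax k)]⟩
      rw [den_unique hy' hv] at hy
      exact ⟨j, hy⟩
  have top_exists : ∀ j : ℕ, ∃ u, Top u ∧ Den u (chainMax ((j + 1) ^ 2)) := by
    intro j
    have hmem : (chainMax ((j + 1) ^ 2) : X T ord) ∈ Y T ord :=
      (chain_mem_Y_iff ord hT _ _).2 ⟨j + 1, Nat.le_add_left _ _, rfl⟩
    obtain ⟨u, hu, hux⟩ := can_exists hmem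
    refine ⟨u, ⟨hu, (sl_iff hux).2 (Or.inr ⟨_, _, rfl⟩), ?_, ?_⟩, hux⟩
    · rintro ⟨v, rfl, y, hy, hy'⟩
      have := (den_unique hy hux).symm.trans (den_unique hy' hz)
      cases this
    · rintro v hv ⟨a, b, ha, hb, hab⟩
      have e := den_unique hab hux
      rw [den_unique ha hux] at e
      refine ⟨_, hux, ?_⟩
      rcases (sl_iff hb).1 hv with rfl | ⟨i, k, rfl⟩
      · cases e
      · by_cases hi : (j + 1) ^ 2 = i
        · subst hi
          rw [chainMax, mul_chain_chain, min_eq_right (le_chainMax k)] at e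
          rwa [chainMax, ← e]
        · rw [chainMax, mul, if_neg hi] at e
          cases e
  -- canonical words of the elements below a given one
  let Below (u v : List A) : Prop := Top u ∧ Can v ∧ Sl v ∧ Mul v u v
  obtain ⟨c, hc⟩ := Rec.exists_length_le (P := Below)
    ((rec_top _).and ((rec_can _).and ((rec_sl _).and (rec_mul _ _ _))))
  -- Besides the zero, only elements of the same chain lie below a chain maximum, and each has a
  -- single canonical word.
  have below_finite : ∀ u, {v | Below u v}.Finite := by
    intro u
    by_cases hu : Top u
    · obtain ⟨j, hj⟩ := top_max hu
      have hfin : (insert zero (Set.range (chain (j ^ 2))) : Set (X T ord)).Finite :=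
        (Set.finite_range _).insert _
      have hden : ∀ v, Below u v → ∃ x, Den v x ∧
          x ∈ (insert zero (Set.range (chain (j ^ 2))) : Set (X T ord)) := by
        rintro v ⟨-, ⟨⟨x, hx, -⟩, -⟩, hs, a, b, ha, hb, hab⟩
        refine ⟨x, hx, ?_⟩
        have e := den_unique hab hx
        rw [den_unique ha hx, den_unique hb hj] at e
        rcases (sl_iff hx).1 hs with rfl | ⟨i, k, rfl⟩
        · exact Or.inl rfl
        · by_cases hi : i = j ^ 2
          · subst hi
            exact Or.inr ⟨k, rfl⟩
          · rw [chainMax, mul, if_neg hi] at e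
            cases e
      have : Nonempty (X T ord) := ⟨zero⟩
      choose! f hf using hden
      refine Set.Finite.of_injOn (f := f) (fun v hv => (hf v hv).2) ?_ hfin
      intro v hv w hw e
      exact can_unique hv.2.1 hw.2.1 (hf v hv).1 (e ▸ (hf w hw).1)
    · refine Set.Finite.subset Set.finite_empty fun v hv => hu hv.1
  have below_card : ∀ {u j}, Top u → Den u (chainMax (j ^ 2)) →
      2 ^ j ^ 2 ≤ {v | Below u v}.ncard := by
    intro u j hu hj
    have hmem : ∀ k, ∃ v, Can v ∧ Den v (chain (j ^ 2) k) :=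
      fun k => can_exists (hchain (den_mem hj) k)
    choose f hf using hmem
    have inj : Function.Injective f := by
      intro k l e
      have := den_unique (hf k).2 (e ▸ (hf l).2)
      exact eq_of_heq (chain.inj this).2
    have : (Set.range f).ncard = 2 ^ j ^ 2 := by
      rw [← Set.image_univ, Set.ncard_image_of_injective _ inj, Set.ncard_univ, Nat.card_fin]
    rw [← this]
    refine Set.ncard_le_ncard ?_ (below_finite u)
    rintro _ ⟨k, rfl⟩
    refine ⟨hu, (hf k).1, (sl_iff (hf k).2).2 (Or.inr ⟨_, _, rfl⟩), _, _, (hf k).2, hj, ?_⟩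
    rw [chainMax, mul_chain_chain, min_eq_left (le_chainMax k)]
    exact (hf k).2
  choose! J hJ using fun u (hu : Top u) => top_max hu
  have hreg : _root_.Language.IsRegular ({u | Top u} : Set (List A)) := (rec_top _).isRegular
  have hinf : Set.Infinite {u | Top u} := by
    choose f hf using top_exists
    refine Set.infinite_of_injective_forall_mem (f := f) ?_ fun j => (hf j).1
    intro j l e
    have := (chain.inj (den_unique (hf j).2 (e ▸ (hf l).2))).1
    have := Nat.pow_left_injective two_ne_zero this
    omega
  have hinj : Set.InjOn J {u | Top u} := by
    intro u hu v hv e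
    exact can_unique hu.1 hv.1 (hJ u hu) (e ▸ hJ v hv)
  obtain ⟨u, hu, hlt⟩ := exists_lt_sq_of_isRegular hreg hinf hinj (Nat.card A + 1) c
  have h1 : 2 ^ J u ^ 2 ≤ (Nat.card A + 1) ^ (u.length + c) :=
    (below_card hu (hJ u hu)).trans
      (ncard_le_of_length_le fun v hv => hc u (below_finite u) v hv)
  -- The crude bound $d\le2^d$ for $d=|A|+1$ brings the estimate to base 2, so that comparing
  -- exponents gives a bound on $j^2$ linear in the length of `u`.
  have h2 : (Nat.card A + 1) ^ (u.length + c) ≤ 2 ^ ((Nat.card A + 1) * (u.length + c)) := by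
    rw [pow_mul]
    exact Nat.pow_le_pow_left (Nat.lt_two_pow_self).le _
  exact absurd ((Nat.pow_le_pow_iff_right (by norm_num)).1 (h1.trans h2)) (not_le.2 hlt)

end SquareAlgebra

/-! ### The signature, and runs of Turing machines -/

namespace SquareAlgebra

open Turing

theorem isAlgebraic_sig : sig.IsAlgebraic :=
  fun _ => inferInstanceAs (IsEmpty Empty)

theorem finite_symbols_sig : Finite sig.Symbols := by
  let f : sig.Symbols → Option (Fin 5) := fun s => match s with
    | .inl ⟨_, .mul⟩ => none
    | .inl ⟨_, .alpha⟩ => some 0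
    | .inl ⟨_, .beta⟩ => some 1
    | .inl ⟨_, .gamma⟩ => some 2
    | .inl ⟨_, .delta⟩ => some 3
    | .inl ⟨_, .zeta⟩ => some 4
    | .inr r => r.2.elim
  refine Finite.of_injective f ?_
  rintro (⟨_, _ | _ | _ | _ | _ | _⟩ | r) (⟨_, _ | _ | _ | _ | _ | _⟩ | r') h <;>
    first | rfl | exact r.2.elim | exact r'.2.elim | simp [f] at h

namespace Machine

section Run

variable {B Q : Type} [Inhabited B] (T : Machine B Q)

/-- `T` reaches `d` from `c`, and is not in state `sq` before. -/
def Run (c d : Config B Q) : Prop :=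
  ∃ n, T.step^[n] c = d ∧ ∀ m < n, (T.step^[m] c).state ≠ T.sq

variable {T}

theorem Run.refl (c : Config B Q) : T.Run c c := ⟨0, rfl, fun _ h => absurd h (Nat.not_lt_zero _)⟩

theorem Run.trans {c d e : Config B Q} (h : T.Run c d) (h' : T.Run d e) : T.Run c e := by
  obtain ⟨n, rfl, hn⟩ := h
  obtain ⟨k, rfl, hk⟩ := h'
  refine ⟨k + n, Function.iterate_add_apply _ _ _ _, fun m hm => ?_⟩
  rcases lt_or_ge m n with h | h
  · exact hn m h
  · obtain ⟨l, rfl⟩ := Nat.exists_eq_add_of_le h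
    rw [add_comm, Function.iterate_add_apply]
    exact hk l (by omega)

theorem Run.of_step {c : Config B Q} (h : c.state ≠ T.sq) : T.Run c (T.step c) :=
  ⟨1, rfl, fun m hm => by rwa [Nat.lt_one_iff.1 hm]⟩

/-- The configuration with state `q`, the word `l` to the left of the head, read leftwards, and
the word `r` from the head rightwards. -/
def cfg (l : List B) (q : Q) (r : List B) : Config B Q :=
  ⟨q, Tape.mk' (ListBlank.mk l) (ListBlank.mk r)⟩

theorem cfg_append_left (l : List B) (q : Q) (r : List B) :
    cfg (l ++ [default]) q r = cfg l q r := by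
  rw [cfg, ← List.replicate_one, mk_append_replicate]
  rfl

theorem cfg_append_right (l : List B) (q : Q) (r : List B) :
    cfg l q (r ++ [default]) = cfg l q r := by
  rw [cfg, ← List.replicate_one, mk_append_replicate]
  rfl

variable (T)

theorem run_right {q q' : Q} {b b' : B} (h : T.trans q b = (q', b', Dir.right)) (hq : q ≠ T.sq)
    (l r : List B) : T.Run (cfg l q (b :: r)) (cfg (b' :: l) q' r) := by
  have : T.step (cfg l q (b :: r)) = cfg (b' :: l) q' r := by
    simp [step, cfg, h, ListBlank.cons_mk]
  rw [← this]
  exact Run.of_step hq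

theorem step_cfg_left {q q' : Q} {b b' : B} (h : T.trans q b = (q', b', Dir.left))
    (d : B) (l r : List B) : T.step (cfg (d :: l) q (b :: r)) = cfg l q' (d :: b' :: r) := by
  simp [step, cfg, h, ListBlank.cons_mk]

theorem run_left {q q' : Q} {b b' : B} (h : T.trans q b = (q', b', Dir.left)) (hq : q ≠ T.sq)
    (d : B) (l r : List B) : T.Run (cfg (d :: l) q (b :: r)) (cfg l q' (d :: b' :: r)) := by
  rw [← T.step_cfg_left h]
  exact Run.of_step hq

theorem run_scan_right {q : Q} {b b' : B} (h : T.trans q b = (q, b', Dir.right)) (hq : q ≠ T.sq)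
    (n : ℕ) (l r : List B) :
    T.Run (cfg l q (List.replicate n b ++ r)) (cfg (List.replicate n b' ++ l) q r) := by
  induction n generalizing l with
  | zero => exact Run.refl _
  | succ n ih =>
    have e : List.replicate (n + 1) b' ++ l = List.replicate n b' ++ b' :: l := by
      rw [List.replicate_succ', List.append_assoc, List.singleton_append]
    rw [e]
    exact (T.run_right h hq _ _).trans (ih (b' :: l))

theorem run_scan_left {q : Q} {b : B} (h : T.trans q b = (q, b, Dir.left)) (hq : q ≠ T.sq)
    (n : ℕ) (d : B) (l r : List B) :
    T.Run (cfg (List.replicate n b ++ d :: l) q (b :: r))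
      (cfg l q (d :: (List.replicate (n + 1) b ++ r))) := by
  induction n generalizing r with
  | zero => exact T.run_left h hq d l r
  | succ n ih =>
    rw [List.replicate_succ' (n := n + 1), List.append_assoc, List.singleton_append]
    exact (T.run_left h hq _ _ _).trans (ih (b :: r))

end Run

/-! ### A machine that generates the squares -/

/-- The tape symbols of a machine that generates the squares. -/
inductive Symbol
  | blank
  | one
  | mark

/-- The states of a machine that generates the squares. -/
inductive State
  | start
  | sq
  | first
  | app3
  | app2
  | app1
  | back
  | skip
  | clean

instance : Inhabited Symbol := ⟨Symbol.blank⟩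

instance : Finite Symbol :=
  Finite.of_surjective (fun i : Fin 3 => match i with
    | 0 => Symbol.blank
    | 1 => Symbol.one
    | 2 => Symbol.mark) fun s => match s with
    | .blank => ⟨0, rfl⟩
    | .one => ⟨1, rfl⟩
    | .mark => ⟨2, rfl⟩

instance : Finite State :=
  Finite.of_surjective (fun i : Fin 9 => match i with
    | 0 => State.start
    | 1 => State.sq
    | 2 => State.first
    | 3 => State.app3
    | 4 => State.app2
    | 5 => State.app1
    | 6 => State.back
    | 7 => State.skip
    | 8 => State.clean) fun s => match s with
    | .start => ⟨0, rfl⟩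
    | .sq => ⟨1, rfl⟩
    | .first => ⟨2, rfl⟩
    | .app3 => ⟨3, rfl⟩
    | .app2 => ⟨4, rfl⟩
    | .app1 => ⟨5, rfl⟩
    | .back => ⟨6, rfl⟩
    | .skip => ⟨7, rfl⟩
    | .clean => ⟨8, rfl⟩

/-- A machine that generates the squares. In state `sq` its head is on the cell number `j` of the
tape `one ^ j²`. It marks the `j` cells to the left of the head one by one, and for each of them
appends two symbols to the tape, and one more for the first of them. Then it removes the marks. -/
def squares : Machine Symbol State where
  start := .start
  sq := .sq
  a := .one
  a_ne_blank := nofun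
  trans q b := match q, b with
    | .start, _ => (.sq, .one, .right)
    | .sq, b => (.first, b, .left)
    | .first, _ => (.app3, .mark, .right)
    | .app3, .blank => (.app2, .one, .right)
    | .app3, b => (.app3, b, .right)
    | .app2, .blank => (.app1, .one, .right)
    | .app2, b => (.app2, b, .right)
    | .app1, .blank => (.back, .one, .left)
    | .app1, b => (.app1, b, .right)
    | .back, .mark => (.skip, .mark, .left)
    | .back, b => (.back, b, .left)
    | .skip, .mark => (.skip, .mark, .left)
    | .skip, .one => (.app2, .mark, .right)
    | .skip, .blank => (.clean, .blank, .right)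
    | .clean, .mark => (.clean, .one, .right)
    | .clean, _ => (.sq, .one, .right)

namespace squares

open Machine.Symbol List

/-- One round: at the right end two symbols are appended, then the head goes back over the symbols
`one` and over the block of marks to the cell `d` before it, which decides whether another round
follows. -/
theorem run_skip (i t : ℕ) (d : Symbol) (l : List Symbol) :
    squares.Run (cfg (replicate t one ++ (replicate (i + 1) mark ++ d :: l)) .app2 [])
      (cfg l .skip (d :: (replicate (i + 1) mark ++ replicate (t + 2) one))) := by
  have h1 : squares.Run (cfg (replicate t one ++ (replicate (i + 1) mark ++ d :: l)) .app2 [])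
      (cfg (one :: (replicate t one ++ (replicate (i + 1) mark ++ d :: l))) .app1 []) := by
    rw [← cfg_append_right]
    exact squares.run_right (by rfl) (by nofun) _ _
  have h2 : squares.Run
      (cfg (one :: (replicate t one ++ (replicate (i + 1) mark ++ d :: l))) .app1 [])
      (cfg (replicate t one ++ mark :: (replicate i mark ++ d :: l)) .back [one, one]) := by
    rw [← cfg_append_right]
    exact squares.run_left (by rfl) (by nofun) _ _ _
  have h3 : squares.Run
      (cfg (replicate t one ++ mark :: (replicate i mark ++ d :: l)) .back [one, one])
      (cfg (replicate i mark ++ d :: l) .back (mark :: replicate (t + 2) one)) := by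
    rw [replicate_succ' (n := t + 1)]
    exact squares.run_scan_left (by rfl) (by nofun) t _ _ _
  refine h1.trans (h2.trans (h3.trans ?_))
  cases i with
  | zero => exact squares.run_left (by rfl) (by nofun) _ _ _
  | succ i =>
    refine (squares.run_left (b' := mark) (by rfl) (by nofun) _ _ _).trans ?_
    rw [replicate_succ' (n := i + 1), append_assoc, singleton_append]
    exact squares.run_scan_left (by rfl) (by nofun) i _ _ _

/-- Induction on the number `p` of cells still to be marked; each round turns one of them into a
mark and lengthens the right part by two. -/
theorem run_sq (p i t : ℕ) :
    squares.Run (cfg (replicate t one ++ (replicate (i + 1) mark ++ replicate p one)) .app2 [])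
      (cfg (replicate (i + p + 2) one) .sq (replicate (t + 2 * p + 1) one)) := by
  induction p generalizing i t with
  | zero =>
    -- No cell is left to be marked, so the cell before the marks is a blank. The marks are then
    -- erased, and the head passes one further `one`, which moves from the right part to the left.
    rw [← cfg_append_left, append_assoc, append_assoc]
    refine (run_skip i t default []).trans ?_
    refine (squares.run_right (b' := blank) (by rfl) (by nofun) _ _).trans ?_
    refine (squares.run_scan_right (b' := one) (by rfl) (by nofun) _ _ _).trans ?_
    rw [← cfg_append_left (replicate (i + 0 + 2) one)]
    exact squares.run_right (by rfl) (by nofun) _ _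
  | succ p ih =>
    refine (run_skip i t one (replicate p one)).trans ?_
    refine (squares.run_right (b' := mark) (by rfl) (by nofun) _ _).trans ?_
    refine (squares.run_scan_right (b' := mark) (by rfl) (by nofun) _ _ _).trans ?_
    rw [← append_nil (replicate (t + 2) one)]
    refine (squares.run_scan_right (b' := one) (by rfl) (by nofun) _ _ _).trans ?_
    have := ih (i + 1) (t + 2)
    rw [replicate_succ' (n := i + 1), append_assoc, singleton_append] at this
    convert this using 3 <;> ring

/-- The configuration in state `sq` with tape contents `one ^ (j + 1)²`. -/
def output (j : ℕ) : Config Symbol State :=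
  cfg (replicate (j + 1) one) .sq (replicate (j * (j + 1)) one)

theorem outputs_output (j : ℕ) : squares.Outputs (output j) ((j + 1) ^ 2) := by
  have h : output j = Config.ofLists (replicate (j + 1) one) .sq (replicate (j * (j + 1)) one) := by
    simp [output, cfg, Config.ofLists]
  refine ⟨rfl, ?_⟩
  rw [h, Config.contents, Config.left_ofLists, Config.right_ofLists, replicate_append_replicate]
  · congr 1
    ring
  · rw [getLast?_replicate]
    split_ifs <;> simp [default]
  · simp [replicate_succ, default]

theorem run_output (j : ℕ) : squares.Run (squares.step (output j)) (output (j + 1)) := by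
  have h : squares.step (output j) =
      cfg (replicate j one) .first (one :: replicate (j * (j + 1)) one) := by
    -- For `j = 0` the head in state `sq` is on a blank, which has to be made explicit; it is
    -- written back unchanged.
    rcases h : j * (j + 1) with _ | n
    · rw [output, h, ← cfg_append_right, ← cfg_append_right _ _ (one :: _)]
      exact squares.step_cfg_left (by rfl) _ _ _
    · rw [output, h]
      exact squares.step_cfg_left (by rfl) _ _ _
  rw [h]
  refine (squares.run_right (b' := mark) (by rfl) (by nofun) _ _).trans ?_
  rw [← append_nil (replicate (j * (j + 1)) one)]
  refine (squares.run_scan_right (b' := one) (by rfl) (by nofun) _ _ _).trans ?_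
  rw [← cfg_append_right]
  refine (squares.run_right (b' := one) (by rfl) (by nofun) _ _).trans ?_
  -- The first of the `j + 1` cells has been marked and one symbol appended. The remaining `j` cells
  -- contribute two symbols each, and two more come from the round that finds no further cell.
  have := run_sq j 0 (j * (j + 1) + 1)
  change squares.Run (cfg (one :: (replicate (j * (j + 1)) one ++ mark :: replicate j one)) _ _)
    _ at this
  rw [output]
  convert this using 3 <;> ring

theorem step_init : squares.step squares.init = output 0 := by
  have : squares.init = cfg [] .start [default] := by
    rw [← nil_append [default], cfg_append_right]
    rfl
  rw [this]
  simp [step, cfg, output, squares, ListBlank.cons_mk]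

theorem generatesSquares : squares.GeneratesSquares := by
  choose n hn hsq using run_output
  -- `τ j` is the time at which the contents $a^{(j+1)^2}$ are output; the first output occurs after
  -- one step.
  let τ : ℕ → ℕ := fun j => Nat.rec 1 (fun j s => n j + 1 + s) j
  have hτ : ∀ j, squares.step^[τ j] squares.init = output j := by
    intro j
    induction j with
    | zero => exact step_init
    | succ j ih =>
      change squares.step^[n j + 1 + τ j] _ = _
      rw [Function.iterate_add_apply, ih, Function.iterate_succ_apply, hn]
  -- The required times are indexed from 1; index 0 receives the time 0, which precedes the first
  -- output.
  refine ⟨⟨fun j => j.casesOn 0 τ, strictMono_nat_of_lt_succ fun j => ?_, fun j hj => ?_⟩,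
    fun N hN => ?_⟩
  · cases j with
    | zero => exact Nat.zero_lt_one
    | succ j => exact Nat.lt_add_of_pos_left (Nat.succ_pos _)
  · obtain ⟨j, rfl⟩ := Nat.exists_eq_add_of_le' hj
    change squares.Outputs (squares.step^[τ j] _) _
    rw [hτ]
    exact outputs_output j
  -- Every positive time lies in one of the intervals from an output up to the next one, and inside
  -- such an interval the state is not `sq`, by the second clause of `Run`.
  · have split : ∀ N, ∃ j m, N + 1 = m + τ j ∧ m < n j + 1 := by
      intro N
      induction N with
      | zero => exact ⟨0, 0, rfl, Nat.succ_pos _⟩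
      | succ N ih =>
        obtain ⟨j, m, h, hm⟩ := ih
        rcases Nat.lt_or_ge (m + 1) (n j + 1) with h' | h'
        · exact ⟨j, m + 1, by omega, h'⟩
        · refine ⟨j + 1, 0, ?_, Nat.succ_pos _⟩
          change _ = 0 + (n j + 1 + τ j)
          omega
    cases N with
    | zero => cases hN
    | succ N =>
      obtain ⟨j, m, h, hm⟩ := split N
      rw [h, Function.iterate_add_apply, hτ] at hN ⊢
      cases m with
      | zero => exact ⟨j + 1, Nat.le_add_left _ _, outputs_output j⟩
      | succ m => exact absurd hN (hsq j m (Nat.lt_of_succ_lt_succ hm))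

end squares

end Machine

end SquareAlgebra

theorem mainTheorem4 :
    (∃ (B Q : Type) (_ : Finite B) (_ : Finite Q) (_ : Inhabited B)
      (T : SquareAlgebra.Machine B Q), T.GeneratesSquares) ∧
    (∀ (B Q : Type) [Finite B] [Finite Q] [Inhabited B]
      (T : SquareAlgebra.Machine B Q) (ord : LinearOrder (B ⊕ Q)), T.GeneratesSquares →
        FA.Presentable SquareAlgebra.sig (SquareAlgebra.X T ord) ∧
        FirstOrder.Language.Structure.FG SquareAlgebra.sig (SquareAlgebra.X T ord) ∧
        (SquareAlgebra.Y T ord : Set (SquareAlgebra.X T ord)) =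
          {SquareAlgebra.X.zero} ∪
          {x | ∃ n : ℕ, x = SquareAlgebra.X.bot (T.step^[n] T.init)} ∪
          {x | ∃ (j : ℕ) (k : Fin (2 ^ j ^ 2)), 1 ≤ j ∧ x = SquareAlgebra.X.chain (j ^ 2) k} ∧
        (∀ (i : ℕ) (k : Fin (2 ^ i)),
          SquareAlgebra.X.chain i k ∈ SquareAlgebra.Y T ord ↔ ∃ j : ℕ, 1 ≤ j ∧ i = j ^ 2) ∧
        ¬ FA.Presentable SquareAlgebra.sig (SquareAlgebra.Y T ord)) ∧
    (∃ (𝓛 : FirstOrder.Language.{0, 0}) (_ : 𝓛.IsAlgebraic) (_ : Finite 𝓛.Symbols)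
      (A : Type) (_ : 𝓛.Structure A) (C : 𝓛.Substructure A),
        FA.Presentable 𝓛 A ∧ FirstOrder.Language.Structure.FG 𝓛 A ∧
        C.FG ∧ ¬ FA.Presentable 𝓛 C) := by
  have hT := SquareAlgebra.Machine.squares.generatesSquares
  refine ⟨⟨_, _, inferInstance, inferInstance, inferInstance, _, hT⟩,
    fun B Q _ _ _ T ord hT => ⟨SquareAlgebra.X.presentable T ord, SquareAlgebra.X.fg T ord,
      SquareAlgebra.coe_Y ord hT, SquareAlgebra.chain_mem_Y_iff ord hT,
      SquareAlgebra.not_presentable_Y hT⟩, ?_⟩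
  have ord : LinearOrder (SquareAlgebra.Machine.Symbol ⊕ SquareAlgebra.Machine.State) :=
    LinearOrder.lift' (Finite.equivFin _) (Finite.equivFin _).injective
  exact ⟨SquareAlgebra.sig, SquareAlgebra.isAlgebraic_sig, SquareAlgebra.finite_symbols_sig,
    SquareAlgebra.X SquareAlgebra.Machine.squares ord, inferInstance,
    SquareAlgebra.Y SquareAlgebra.Machine.squares ord, SquareAlgebra.X.presentable _ _,
    SquareAlgebra.X.fg _ _, FirstOrder.Language.Substructure.fg_closure_singleton _,
    SquareAlgebra.not_presentable_Y hT⟩
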